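/- Let $d_A,d_B\ge 1$ and let $\mathcal H_A=\mathbb C^{d_A}$, $\mathcal H_B=\mathbb C^{d_B}$ with their computational bases. The Schmidt rank of an operator $U$ on a tensor product $\mathcal K\otimes\mathcal L$ is the number $n$ of terms in an expansion $U=\sum_{j=1}^n A_j\otimes B_j$ with $A_1,\dots,A_n$ linearly independent and $B_1,\dots,B_n$ linearly independent. A standard gate is a unitary on $\mathcal H_A\otimes\mathcal H_B$ of the form $V_{ab}\oplus I$, where $\mathcal H_a\subseteq\mathcal H_A$ and $\mathcal H_b\subseteq\mathcal H_B$ are two-dimensional subspaces, $V_{ab}$ (the nontrivial part) is a unitary of Schmidt rank $2$ on $\mathcal H_a\otimes\mathcal H_b$, and $I$ is the identity on the orthogonal complement of $\mathcal H_a\otimes\mathcal H_b$. A local unitary is an operator $S\otimes T$ with $S$, $T$ unitary; a local permutation gate is an operator $P\otimes Q$ with $P$, $Q$ permutation matrices. An operator $U$ is a product of $n$ gates interspersed with local unitaries (local permutation gates) if $U=L_0G_1L_1\cdots G_nL_n$ with gates $G_i$ and local unitaries (local permutation gates) $L_i$. (i) Every unitary on $\mathcal H_A\otimes\mathcal H_B$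 is a product of at most $$2(d_A-1)^2\left\lfloor\tfrac{d_B}{2}\right\rfloor+(2d_A-3)(d_B-1)\left\lfloor\tfrac{d_A}{2}\right\rfloor$$ standard gates interspersed with local unitaries. (ii) Every controlled unitary controlled from the $A$ side, that is, every operator of the form $K\big(\sum_{j=1}^{d_A}|j\rangle\langle j|\otimes W_j\big)L$ with local unitaries $K$, $L$ and unitaries $W_j$ on $\mathcal H_B$, is a product of at most $(d_A-1)\lfloor d_B/2\rfloor$ standard gates interspersed with local unitaries. (iii) Every complex permutation unitary on $\mathcal H_A\otimes\mathcal H_B$, that is, every unitary matrix in the computational product basis with exactly one nonzero entry in each row and in each column, is a product of at most $2(d_A-1)\lfloor d_B/2\rfloor+(d_B-1)\lfloor d_A/2\rfloor$ standard gates interspersed with local unitaries. (iv) Every permutation matrix on $\mathcal H_A\otimes\mathcal H_B$ (in the computational product basis) is a product of at most $3(d_A-1)(d_B-1)$ standard gates whose nontrivial part is a CNOT, interspersed with local permutation gates. Here each of $\mathcal H_a$, $\mathcal H_b$ is spanned by two computational basis vectors, the CNOT is taken with respect to these, and either party may be the control. -/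

import Mathlib

open Matrix
open scoped Kronecker

/-- Operators on `ℂ^dA ⊗ ℂ^dB`, as matrices in the computational product basis
`|i⟩ ⊗ |j⟩ = |i, j⟩`. -/
abbrev BipartiteMatrix (dA dB : ℕ) : Type :=
  Matrix (Fin dA × Fin dB) (Fin dA × Fin dB) ℂ

/-- `U` has (operator) Schmidt rank `n`: `U = ∑ j, A j ⊗ B j` with `n` terms, the `A j` linearly
independent and the `B j` linearly independent. -/
def HasSchmidtRank {dA dB : ℕ} (U : BipartiteMatrix dA dB) (n : ℕ) : Prop :=
  ∃ (A : Fin n → Matrix (Fin dA) (Fin dA) ℂ) (B : Fin n → Matrix (Fin dB) (Fin dB) ℂ),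
    LinearIndependent ℂ A ∧ LinearIndependent ℂ B ∧ U = ∑ j, A j ⊗ₖ B j

/-- Local unitaries `S ⊗ T`. -/
def IsLocalUnitary {dA dB : ℕ} (L : BipartiteMatrix dA dB) : Prop :=
  ∃ S ∈ unitaryGroup (Fin dA) ℂ, ∃ T ∈ unitaryGroup (Fin dB) ℂ, L = S ⊗ₖ T

/-- Local permutation gates `P ⊗ Q`, with `P` and `Q` permutation matrices. -/
def IsLocalPermutation {dA dB : ℕ} (L : BipartiteMatrix dA dB) : Prop :=
  ∃ (σ : Equiv.Perm (Fin dA)) (τ : Equiv.Perm (Fin dB)),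
    L = σ.permMatrix ℂ ⊗ₖ τ.permMatrix ℂ

/-- `V_{ab} ⊕ I`: the operator acting as `V` on `ℋ_a ⊗ ℋ_b` and as the identity on its orthogonal
complement, where `ℋ_a`, `ℋ_b` are the column spaces of `E`, `F` and their (orthonormal) columns
identify them with `ℂ²`. -/
noncomputable def extendGate {dA dB : ℕ} (E : Matrix (Fin dA) (Fin 2) ℂ)
    (F : Matrix (Fin dB) (Fin 2) ℂ) (V : BipartiteMatrix 2 2) : BipartiteMatrix dA dB :=
  (E ⊗ₖ F) * V * (E ⊗ₖ F)ᴴ + (1 - (E ⊗ₖ F) * (E ⊗ₖ F)ᴴ)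

/-- Standard gates: `V_{ab} ⊕ I` with two-dimensional subspaces `ℋ_a ⊆ ℂ^dA`, `ℋ_b ⊆ ℂ^dB`
(spanned by the orthonormal columns of `E` and `F`) and a unitary `V_{ab}` on `ℋ_a ⊗ ℋ_b` of
Schmidt rank two. -/
def IsStandardGate {dA dB : ℕ} (G : BipartiteMatrix dA dB) : Prop :=
  ∃ (E : Matrix (Fin dA) (Fin 2) ℂ) (F : Matrix (Fin dB) (Fin 2) ℂ) (V : BipartiteMatrix 2 2),
    Eᴴ * E = 1 ∧ Fᴴ * F = 1 ∧
    V ∈ unitaryGroup (Fin 2 × Fin 2) ℂ ∧ HasSchmidtRank V 2 ∧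
    G = extendGate E F V

/-- The matrix whose columns are the computational basis vectors `|a 0⟩` and `|a 1⟩`. -/
def basisFrame {d : ℕ} (a : Fin 2 ↪ Fin d) : Matrix (Fin d) (Fin 2) ℂ :=
  Matrix.of fun i s => if i = a s then 1 else 0

/-- The two-qubit CNOT with control on the first qubit. -/
def cnotA : BipartiteMatrix 2 2 :=
  !![1, 0; 0, 0] ⊗ₖ !![1, 0; 0, 1] + !![0, 0; 0, 1] ⊗ₖ !![0, 1; 1, 0]

/-- The two-qubit CNOT with control on the second qubit. -/
def cnotB : BipartiteMatrix 2 2 :=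
  !![1, 0; 0, 1] ⊗ₖ !![1, 0; 0, 0] + !![0, 1; 1, 0] ⊗ₖ !![0, 0; 0, 1]

/-- Standard gates whose nontrivial part is a CNOT in the computational basis (with either party
as the control): `ℋ_a` and `ℋ_b` are each spanned by two computational basis vectors. -/
def IsCNOTGate {dA dB : ℕ} (G : BipartiteMatrix dA dB) : Prop :=
  ∃ (a : Fin 2 ↪ Fin dA) (b : Fin 2 ↪ Fin dB),
    G = extendGate (basisFrame a) (basisFrame b) cnotA ∨
    G = extendGate (basisFrame a) (basisFrame b) cnotB

/-- `U = L₀ G₁ L₁ G₂ L₂ ⋯ Gₙ Lₙ` with every `Gᵢ` satisfying `gate` and every `Lᵢ` satisfying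
`loc`: a product of `n` gates interspersed with local operations. -/
def IsProductOfGates {dA dB : ℕ} (gate loc : BipartiteMatrix dA dB → Prop) (n : ℕ)
    (U : BipartiteMatrix dA dB) : Prop :=
  ∃ (L : Fin (n + 1) → BipartiteMatrix dA dB) (G : Fin n → BipartiteMatrix dA dB),
    (∀ i, loc (L i)) ∧ (∀ i, gate (G i)) ∧
    U = L 0 * (List.ofFn fun i : Fin n => G i * L i.succ).prod

/-- Controlled unitaries controlled from the `A` side: equivalent, under local unitaries on both
sides, to `∑ j, |j⟩⟨j| ⊗ W j` with unitary `W j`. -/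
def IsControlledFromA {dA dB : ℕ} (U : BipartiteMatrix dA dB) : Prop :=
  ∃ (K L : BipartiteMatrix dA dB) (W : Fin dA → Matrix (Fin dB) (Fin dB) ℂ),
    IsLocalUnitary K ∧ IsLocalUnitary L ∧ (∀ j, W j ∈ unitaryGroup (Fin dB) ℂ) ∧
    U = K * (∑ j, Matrix.single j j (1 : ℂ) ⊗ₖ W j) * L

/-- Complex permutation unitaries: unitary matrices, in the computational product basis, with one
and only one nonzero entry in each row and in each column. -/
def IsComplexPermutation {dA dB : ℕ} (U : BipartiteMatrix dA dB) : Prop :=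
  U ∈ unitaryGroup (Fin dA × Fin dB) ℂ ∧
    (∀ i, ∃! j, U i j ≠ 0) ∧ (∀ j, ∃! i, U i j ≠ 0)

/-! All four bounds reduce to controlled operators. Let the first party control `W j`. Multiplying
by `1 ⊗ W z⁻¹` is local and makes one slot trivial, so `dA - 1` operators remain, each acting
nontrivially for a single control state `j`. Such an operator costs at most `dB / 2` standard gates:
diagonalize its unitary by a local basis change, pair off unequal eigenvalues, and note that each
pair is one gate on a plane containing `|j⟩` and an idle `|i⟩`. When no unequal pair is left, the
remaining eigenvalues share one phase, which a local phase on `|j⟩` cancels. If the `W j` are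
permutations, each is a product of at most `dB - 1` transpositions, and a controlled transposition
is a CNOT gate. Exchanging the parties gives the mirrored bounds for control from the second party.

Permutations of the product basis factor as row, column, row permutations of the `dA × dB` grid
(`exists_row_column_row_decomposition`): regard the cell `e` as an edge from its row to the row of
`σ e`, and use a proper `dB`-colouring of this regular bipartite multigraph (Hall's theorem) as the
choice of intermediate columns. This gives two factors controlled by the first party and one by the
second; for complex permutations the phases are absorbed into a controlled factor.

For an arbitrary unitary, split the first party into two nearly equal parts. The cosine-sine
decomposition gives `(W ⊕ Y) M (W' ⊕ Y')`, where the rotations making up `M` are controlled by the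
second party. Recursing on the two summands in parallel with `dA ≤ 2 ^ k` yields `2 ^ k` factors
controlled by the first party and `2 ^ k - 1` by the second
(`isAlternatingProduct_of_mem_unitaryGroup`). The stated bound follows from `2 ^ k ≤ 2 * (dA - 1)`
for the least such `k`, when `dA ≥ 2`. -/

/-! ### Calculus of gate counts. -/

section Products

variable {dA dB : ℕ} {gate loc : BipartiteMatrix dA dB → Prop} {n k : ℕ} {U V : BipartiteMatrix dA dB}

theorem isProductOfGates_zero : IsProductOfGates gate loc 0 U ↔ loc U := by
  constructor
  · rintro ⟨L, G, hL, -, rfl⟩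
    simpa using hL 0
  · intro h
    exact ⟨fun _ => U, Fin.elim0, fun _ => h, fun i => i.elim0, by simp⟩

/-- Peeling off the leftmost gate replaces the indexed families by a recursion on the count, the
form used in every induction below. -/
theorem isProductOfGates_succ : IsProductOfGates gate loc (n + 1) U ↔
    ∃ L G V, loc L ∧ gate G ∧ IsProductOfGates gate loc n V ∧ U = L * G * V := by
  constructor
  · rintro ⟨L, G, hL, hG, rfl⟩
    refine ⟨L 0, G 0, _, hL 0, hG 0,
      ⟨fun i => L i.succ, fun i => G i.succ, fun i => hL _, fun i => hG _, rfl⟩, ?_⟩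
    simp [List.ofFn_succ, mul_assoc]
  · rintro ⟨L, G, V, hL, hG, ⟨L', G', hL', hG', rfl⟩, rfl⟩
    refine ⟨Fin.cons L L', Fin.cons G G', ?_, ?_, ?_⟩
    · intro i; cases i using Fin.cases <;> simp [hL, hL']
    · intro i; cases i using Fin.cases <;> simp [hG, hG']
    · simp [List.ofFn_succ, mul_assoc]

/-- `U` is a product of at most `n` gates interspersed with local operations. -/
def IsProductOfAtMost (gate loc : BipartiteMatrix dA dB → Prop) (n : ℕ)
    (U : BipartiteMatrix dA dB) : Prop :=
  ∃ k ≤ n, IsProductOfGates gate loc k U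

theorem IsProductOfAtMost.mono (h : IsProductOfAtMost gate loc n U) (hk : n ≤ k) :
    IsProductOfAtMost gate loc k U :=
  let ⟨l, hl, h⟩ := h
  ⟨l, hl.trans hk, h⟩

theorem IsProductOfAtMost.of_loc (h : loc U) : IsProductOfAtMost gate loc n U :=
  ⟨0, n.zero_le, isProductOfGates_zero.2 h⟩

theorem IsProductOfAtMost.of_gate (h1 : loc 1) (h : gate U) : IsProductOfAtMost gate loc 1 U :=
  ⟨1, le_rfl, isProductOfGates_succ.2 ⟨1, U, 1, h1, h, isProductOfGates_zero.2 h1, by simp⟩⟩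

variable (hloc : ∀ U V, loc U → loc V → loc (U * V))

include hloc in
theorem IsProductOfGates.loc_mul {L : BipartiteMatrix dA dB} (hL : loc L)
    (h : IsProductOfGates gate loc n U) : IsProductOfGates gate loc n (L * U) := by
  cases n with
  | zero => exact isProductOfGates_zero.2 (hloc _ _ hL (isProductOfGates_zero.1 h))
  | succ n =>
    obtain ⟨K, G, V, hK, hG, hV, rfl⟩ := isProductOfGates_succ.1 h
    exact isProductOfGates_succ.2 ⟨L * K, G, V, hloc _ _ hL hK, hG, hV, by simp [mul_assoc]⟩

-- Where two products meet, their adjacent local operations merge into one, so the gate counts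
-- simply add.
include hloc in
theorem IsProductOfGates.mul (hU : IsProductOfGates gate loc n U)
    (hV : IsProductOfGates gate loc k V) : IsProductOfGates gate loc (n + k) (U * V) := by
  induction n generalizing U with
  | zero => simpa using IsProductOfGates.loc_mul hloc (isProductOfGates_zero.1 hU) hV
  | succ n ih =>
    obtain ⟨L, G, U', hL, hG, hU', rfl⟩ := isProductOfGates_succ.1 hU
    rw [Nat.succ_add]
    exact isProductOfGates_succ.2 ⟨L, G, U' * V, hL, hG, ih hU', by simp [mul_assoc]⟩

include hloc in
theorem IsProductOfAtMost.mul (hU : IsProductOfAtMost gate loc n U)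
    (hV : IsProductOfAtMost gate loc k V) : IsProductOfAtMost gate loc (n + k) (U * V) :=
  let ⟨_, hn, hU⟩ := hU
  let ⟨_, hk, hV⟩ := hV
  ⟨_, add_le_add hn hk, hU.mul hloc hV⟩

include hloc in
theorem IsProductOfAtMost.loc_mul {L : BipartiteMatrix dA dB} (hL : loc L)
    (hU : IsProductOfAtMost gate loc n U) : IsProductOfAtMost gate loc n (L * U) := by
  simpa using (IsProductOfAtMost.of_loc (n := 0) hL).mul hloc hU

include hloc in
theorem IsProductOfAtMost.mul_loc {L : BipartiteMatrix dA dB} (hL : loc L)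
    (hU : IsProductOfAtMost gate loc n U) : IsProductOfAtMost gate loc n (U * L) := by
  simpa using hU.mul hloc (IsProductOfAtMost.of_loc (n := 0) hL)

end Products

/-! ### Closure of the local operations under products. -/

section Local

variable {dA dB : ℕ}

theorem IsLocalUnitary.one : IsLocalUnitary (1 : BipartiteMatrix dA dB) :=
  ⟨1, one_mem _, 1, one_mem _, by simp⟩

theorem IsLocalUnitary.mul (U V : BipartiteMatrix dA dB) (hU : IsLocalUnitary U)
    (hV : IsLocalUnitary V) : IsLocalUnitary (U * V) := by
  obtain ⟨S, hS, T, hT, rfl⟩ := hU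
  obtain ⟨S', hS', T', hT', rfl⟩ := hV
  exact ⟨S * S', mul_mem hS hS', T * T', mul_mem hT hT', by rw [mul_kronecker_mul]⟩

theorem IsLocalPermutation.one : IsLocalPermutation (1 : BipartiteMatrix dA dB) :=
  ⟨1, 1, by simp⟩

theorem IsLocalPermutation.mul (U V : BipartiteMatrix dA dB) (hU : IsLocalPermutation U)
    (hV : IsLocalPermutation V) : IsLocalPermutation (U * V) := by
  obtain ⟨S, T, rfl⟩ := hU
  obtain ⟨S', T', rfl⟩ := hV
  exact ⟨S' * S, T' * T, by rw [← mul_kronecker_mul, permMatrix_mul, permMatrix_mul]⟩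

end Local

/-! ### Algebra of controlled operators. -/

section Controlled

variable {m n : Type*}

/-- `∑ i, |i⟩⟨i| ⊗ W i`: the first party controls the second. -/
def ctrlA [DecidableEq m] (W : m → Matrix n n ℂ) : Matrix (m × n) (m × n) ℂ :=
  (blockDiagonal W).submatrix Prod.swap Prod.swap

/-- `∑ j, V j ⊗ |j⟩⟨j|`: the second party controls the first. -/
def ctrlB [DecidableEq n] (V : n → Matrix m m ℂ) : Matrix (m × n) (m × n) ℂ :=
  blockDiagonal V

theorem ctrlA_apply [DecidableEq m] (W : m → Matrix n n ℂ) (x y : m × n) :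
    ctrlA W x y = if x.1 = y.1 then W x.1 x.2 y.2 else 0 := by
  simp [ctrlA, blockDiagonal_apply]

theorem ctrlB_apply [DecidableEq n] (V : n → Matrix m m ℂ) (x y : m × n) :
    ctrlB V x y = if x.2 = y.2 then V x.2 x.1 y.1 else 0 := by
  simp [ctrlB, blockDiagonal_apply]

variable [DecidableEq m]

theorem ctrlA_mul [Fintype m] [Fintype n] (W W' : m → Matrix n n ℂ) : ctrlA (W * W') = ctrlA W * ctrlA W' := by
  have h := submatrix_mul_equiv (blockDiagonal W) (blockDiagonal W') (Prod.swap (α := m))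
    (Equiv.prodComm m n) Prod.swap
  rw [← blockDiagonal_mul] at h
  exact h.symm

theorem ctrlA_conjTranspose (W : m → Matrix n n ℂ) : (ctrlA W)ᴴ = ctrlA fun i => (W i)ᴴ := by
  rw [ctrlA, conjTranspose_submatrix, blockDiagonal_conjTranspose]
  rfl

theorem ctrlA_one [DecidableEq n] : ctrlA (1 : m → Matrix n n ℂ) = 1 := by
  rw [ctrlA, blockDiagonal_one, submatrix_one _ Prod.swap_injective]

theorem ctrlA_const (T : Matrix n n ℂ) : ctrlA (fun _ : m => T) = 1 ⊗ₖ T := by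
  ext ⟨i, j⟩ ⟨i', j'⟩
  simp [ctrlA_apply, one_apply]

theorem ctrlA_eq_sum [Fintype m] (W : m → Matrix n n ℂ) :
    ctrlA W = ∑ i, Matrix.single i i (1 : ℂ) ⊗ₖ W i := by
  ext ⟨i, j⟩ ⟨i', j'⟩
  rw [Matrix.sum_apply, Finset.sum_eq_single i]
  · simp [ctrlA_apply, single_apply]
  · intro k _ hk
    simp [hk]
  · simp

theorem ctrlA_mulSingle [DecidableEq n] (i : m) (T : Matrix n n ℂ) :
    ctrlA (Pi.mulSingle i T) = 1 + Matrix.single i i (1 : ℂ) ⊗ₖ (T - 1) := by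
  ext ⟨k, j⟩ ⟨k', j'⟩
  by_cases h : k = i
  · subst h
    by_cases h' : k = k' <;> simp [ctrlA_apply, one_apply, h']
  · by_cases h' : k = k'
    · subst h'
      simp [ctrlA_apply, one_apply, h, Ne.symm h]
    · simp [ctrlA_apply, one_apply, Ne.symm h, h']

theorem ctrlA_comp_mul [Fintype m] [Fintype n] [DecidableEq n] {G : Type*} [Group G] (φ : G →* Matrix n n ℂ) (g g' : m → G) :
    ctrlA (φ ∘ (g * g')) = ctrlA (φ ∘ g) * ctrlA (φ ∘ g') := by
  rw [← ctrlA_mul]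
  congr 1
  ext1 i
  simp

theorem ctrlA_comp_one [Fintype n] [DecidableEq n] {G : Type*} [Group G] (φ : G →* Matrix n n ℂ) :
    ctrlA (φ ∘ (1 : m → G)) = 1 := by
  rw [← ctrlA_one]
  congr 1
  ext1 i
  simp

end Controlled

/-! ### Reduction to a single active control state. -/

section ControlledCount

variable {dA dB : ℕ} {gate loc : BipartiteMatrix dA dB → Prop}
  {G : Type*} [Group G] (φ : G →* Matrix (Fin dB) (Fin dB) ℂ)

/-- A controlled operator needs `dA - 1` times the number of gates that is needed for an operator
which is nontrivial for only one state of the control. -/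
theorem IsProductOfAtMost.ctrlA {N : ℕ} (hA : 1 ≤ dA)
    (hloc : ∀ U V, loc U → loc V → loc (U * V)) (hφ : ∀ g, loc (1 ⊗ₖ φ g))
    (h : ∀ i j, i ≠ j → ∀ g, IsProductOfAtMost gate loc N (ctrlA (φ ∘ Pi.mulSingle j g)))
    (g : Fin dA → G) : IsProductOfAtMost gate loc ((dA - 1) * N) (ctrlA (φ ∘ g)) := by
  have hone : loc 1 := by simpa using hφ 1
  let z : Fin dA := ⟨0, hA⟩
  -- The set `s` holds the control states that may act nontrivially. Keeping `z` outside it provides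
  -- an idle partner `z ≠ j` for each `j ∈ s`.
  have key : ∀ s : Finset (Fin dA), z ∉ s → ∀ g : Fin dA → G, (∀ i ∉ s, g i = 1) →
      IsProductOfAtMost gate loc (s.card * N) (_root_.ctrlA (φ ∘ g)) := by
    intro s
    induction s using Finset.induction_on with
    | empty =>
      intro _ g hg
      obtain rfl : g = 1 := funext fun i => hg i (by simp)
      rw [ctrlA_comp_one]
      exact .of_loc hone
    | insert j s hj ih =>
      intro hz g hg
      have hsplit : g = Pi.mulSingle j (g j) * Function.update g j 1 := by
        ext1 i
        by_cases hi : i = j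
        · subst hi; simp
        · simp [hi]
      rw [hsplit, ctrlA_comp_mul, Finset.card_insert_of_notMem hj, add_mul, one_mul, add_comm]
      refine (h z j (fun hzj => hz (by simp [hzj])) _).mul hloc
        (ih (fun hzs => hz (by simp [hzs])) _ fun i hi => ?_)
      by_cases hij : i = j
      · subst hij; simp
      · simp [hij, hg i (by simp [hij, hi])]
  -- A constant family is a local operator; factoring it out trivializes the slot `z` and saves one
  -- of the `dA` terms.
  have hsplit : g = (fun _ => g z) * fun i => (g z)⁻¹ * g i := by
    ext1 i
    simp
  rw [hsplit, ctrlA_comp_mul]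
  refine .loc_mul hloc ?_ ?_
  · have := ctrlA_const (m := Fin dA) (φ (g z))
    rw [show φ ∘ (fun _ : Fin dA => g z) = fun _ => φ (g z) from rfl, this]
    exact hφ _
  · have := key (Finset.univ.erase z) (by simp) (fun i => (g z)⁻¹ * g i) (by simp)
    simpa [Finset.card_erase_of_mem] using this

end ControlledCount

/-! ### Symmetry between the two parties. -/

section Swap

/-- Exchange of the two parties. -/
def swapParties {m n : Type*} (U : Matrix (m × n) (m × n) ℂ) : Matrix (n × m) (n × m) ℂ :=
  U.submatrix Prod.swap Prod.swap

variable {m n m' n' : Type*}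

theorem swapParties_swapParties (U : Matrix (m × n) (m × n) ℂ) :
    swapParties (swapParties U) = U := by
  ext ⟨i, j⟩ ⟨i', j'⟩
  rfl

theorem swapParties_kronecker (A : Matrix m m ℂ) (B : Matrix n n ℂ) :
    swapParties (A ⊗ₖ B) = B ⊗ₖ A := by
  ext ⟨i, j⟩ ⟨i', j'⟩
  simp [swapParties, mul_comm]

theorem swapParties_mul [Fintype m] [Fintype n] (U V : Matrix (m × n) (m × n) ℂ) :
    swapParties (U * V) = swapParties U * swapParties V :=
  (submatrix_mul_equiv U V Prod.swap (Equiv.prodComm n m) Prod.swap).symm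

theorem swapParties_one [DecidableEq m] [DecidableEq n] :
    swapParties (1 : Matrix (m × n) (m × n) ℂ) = 1 :=
  submatrix_one _ Prod.swap_injective

theorem swapParties_ctrlA [DecidableEq m] [DecidableEq n] (W : m → Matrix n n ℂ) :
    swapParties (ctrlA W) = ctrlB W := by
  ext ⟨i, j⟩ ⟨i', j'⟩
  rfl

theorem swapParties_mem_unitaryGroup [Fintype m] [Fintype n] [DecidableEq m] [DecidableEq n]
    {U : Matrix (m × n) (m × n) ℂ} (hU : U ∈ unitaryGroup (m × n) ℂ) :
    swapParties U ∈ unitaryGroup (n × m) ℂ := by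
  rw [mem_unitaryGroup_iff] at hU ⊢
  rw [← swapParties_one, ← hU, swapParties_mul]
  rfl

variable {dA dB : ℕ}

theorem swapParties_extendGate (E : Matrix (Fin dA) (Fin 2) ℂ)
    (F : Matrix (Fin dB) (Fin 2) ℂ) (V : BipartiteMatrix 2 2) :
    swapParties (extendGate E F V) = extendGate F E (swapParties V) := by
  have h1 : (E ⊗ₖ F).submatrix Prod.swap (Equiv.prodComm (Fin 2) (Fin 2)) = F ⊗ₖ E := by
    ext ⟨i, j⟩ ⟨i', j'⟩
    simp [mul_comm]
  have h2 : (E ⊗ₖ F)ᴴ.submatrix (Equiv.prodComm (Fin 2) (Fin 2)) Prod.swap = (F ⊗ₖ E)ᴴ := by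
    rw [← h1, conjTranspose_submatrix]
  have h3 : swapParties (E ⊗ₖ F * (E ⊗ₖ F)ᴴ) = F ⊗ₖ E * (F ⊗ₖ E)ᴴ := by
    rw [swapParties, ← submatrix_mul_equiv _ _ _ (Equiv.prodComm (Fin 2) (Fin 2)), h1, h2]
  have h4 : swapParties (E ⊗ₖ F * V * (E ⊗ₖ F)ᴴ) = F ⊗ₖ E * swapParties V * (F ⊗ₖ E)ᴴ := by
    rw [swapParties, ← submatrix_mul_equiv _ _ _ (Equiv.prodComm (Fin 2) (Fin 2)),
      ← submatrix_mul_equiv _ _ _ (Equiv.prodComm (Fin 2) (Fin 2)), h1, h2]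
    rfl
  rw [extendGate, extendGate, ← h3, ← h4, ← swapParties_one]
  rfl

theorem swapParties_cnotA : swapParties cnotA = cnotB := by
  have : cnotB = !![0, 1; 1, 0] ⊗ₖ !![0, 0; 0, 1] + !![1, 0; 0, 1] ⊗ₖ !![1, 0; 0, 0] := by
    rw [cnotB, add_comm]
  rw [cnotB, ← swapParties_kronecker !![1, 0; 0, 0], ← swapParties_kronecker !![0, 0; 0, 1]]
  rfl

theorem swapParties_cnotB : swapParties cnotB = cnotA := by
  rw [← swapParties_cnotA, swapParties_swapParties]

theorem HasSchmidtRank.swapParties {U : BipartiteMatrix dA dB} {n : ℕ} (h : HasSchmidtRank U n) :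
    HasSchmidtRank (swapParties U) n := by
  obtain ⟨A, B, hA, hB, rfl⟩ := h
  refine ⟨B, A, hB, hA, ?_⟩
  ext x y
  simp only [_root_.swapParties, submatrix_apply, Matrix.sum_apply]
  exact Finset.sum_congr rfl fun j _ => mul_comm _ _

theorem IsStandardGate.swapParties {U : BipartiteMatrix dA dB} (h : IsStandardGate U) :
    IsStandardGate (swapParties U) := by
  obtain ⟨E, F, V, hE, hF, hV, hr, rfl⟩ := h
  exact ⟨F, E, _, hF, hE, swapParties_mem_unitaryGroup hV, hr.swapParties,
    swapParties_extendGate E F V⟩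

theorem IsCNOTGate.swapParties {U : BipartiteMatrix dA dB} (h : IsCNOTGate U) :
    IsCNOTGate (swapParties U) := by
  obtain ⟨a, b, rfl | rfl⟩ := h
  · exact ⟨b, a, .inr (by rw [swapParties_extendGate, swapParties_cnotA])⟩
  · exact ⟨b, a, .inl (by rw [swapParties_extendGate, swapParties_cnotB])⟩

theorem IsLocalUnitary.swapParties {U : BipartiteMatrix dA dB} (h : IsLocalUnitary U) :
    IsLocalUnitary (swapParties U) := by
  obtain ⟨S, hS, T, hT, rfl⟩ := h
  exact ⟨T, hT, S, hS, swapParties_kronecker S T⟩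

theorem IsLocalPermutation.swapParties {U : BipartiteMatrix dA dB} (h : IsLocalPermutation U) :
    IsLocalPermutation (swapParties U) := by
  obtain ⟨S, T, rfl⟩ := h
  exact ⟨T, S, swapParties_kronecker _ _⟩

theorem IsProductOfAtMost.swapParties {gate loc : BipartiteMatrix dA dB → Prop}
    {gate' loc' : BipartiteMatrix dB dA → Prop} (hg : ∀ U, gate U → gate' (swapParties U))
    (hl : ∀ U, loc U → loc' (_root_.swapParties U)) {n : ℕ} {U : BipartiteMatrix dA dB}
    (h : IsProductOfAtMost gate loc n U) :
    IsProductOfAtMost gate' loc' n (_root_.swapParties U) := by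
  obtain ⟨k, hk, h⟩ := h
  refine ⟨k, hk, ?_⟩
  clear hk
  induction k generalizing U with
  | zero => exact isProductOfGates_zero.2 (hl _ (isProductOfGates_zero.1 h))
  | succ k ih =>
    obtain ⟨L, G, V, hL, hG, hV, rfl⟩ := isProductOfGates_succ.1 h
    exact isProductOfGates_succ.2 ⟨_, _, _, hl _ hL, hg _ hG, ih hV, by
      rw [swapParties_mul, swapParties_mul]⟩

end Swap

/-! ### Unitary diagonalization through the Cayley transform. -/

section Diagonalization

variable {n : Type*} [Fintype n] [DecidableEq n]

/-- The unit circle is infinite and the spectrum finite. The point `w` off the spectrum makes the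
Cayley transform `i (w + W) (w - W)⁻¹` well defined. -/
theorem exists_norm_eq_one_isUnit_det_sub (W : Matrix n n ℂ) :
    ∃ w : ℂ, ‖w‖ = 1 ∧ IsUnit (w • 1 - W).det := by
  have hinf : (Metric.sphere (0 : ℂ) 1).Infinite := by
    refine (isPreconnected_sphere (by simp [Complex.rank_real_complex]) 0 1).infinite_of_nontrivial ?_
    exact ⟨1, by simp, -1, by simp, by norm_num⟩
  obtain ⟨w, hw, hroot⟩ := hinf.exists_notMem_finset W.charpoly.roots.toFinset
  refine ⟨w, by simpa using hw, isUnit_iff_ne_zero.2 fun h => hroot ?_⟩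
  rw [Multiset.mem_toFinset, Polynomial.mem_roots (charpoly_monic W).ne_zero, Polynomial.IsRoot,
    eval_charpoly, scalar_apply, ← smul_one_eq_diagonal, h]

/-- The diagonal matrix of a family of phases. -/
def phaseMatrix (l : n → unitary ℂ) : Matrix n n ℂ := diagonal fun k => (l k : ℂ)

theorem phaseMatrix_mem_unitaryGroup (l : n → unitary ℂ) : phaseMatrix l ∈ unitaryGroup n ℂ := by
  rw [mem_unitaryGroup_iff, phaseMatrix, star_eq_conjTranspose, diagonal_conjTranspose,
    diagonal_mul_diagonal, ← diagonal_one]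
  congr 1
  ext1 k
  exact Unitary.mul_star_self_of_mem (l k).2

theorem exists_eq_phaseMatrix {d : n → ℂ} (h : diagonal d ∈ unitaryGroup n ℂ) :
    ∃ l, diagonal d = phaseMatrix l := by
  rw [mem_unitaryGroup_iff, star_eq_conjTranspose, diagonal_conjTranspose,
    diagonal_mul_diagonal, ← diagonal_one, diagonal_eq_diagonal_iff] at h
  exact ⟨fun k => ⟨d k, Unitary.mem_iff.2 ⟨by rw [mul_comm]; exact h k, h k⟩⟩, rfl⟩

/-- Unitary matrices are unitarily diagonalizable; the proof applies the spectral theorem to the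
Cayley transform. -/
theorem exists_unitary_diagonalization {W : Matrix n n ℂ} (hW : W ∈ unitaryGroup n ℂ) :
    ∃ Y ∈ unitaryGroup n ℂ, ∃ l, W = Y * phaseMatrix l * Yᴴ := by
  obtain ⟨w, hw, hdet⟩ := exists_norm_eq_one_isUnit_det_sub W
  have hww : star w * w = 1 := by
    rw [Complex.star_def, ← Complex.normSq_eq_conj_mul_self, Complex.normSq_eq_norm_sq, hw]; simp
  have hWW : Wᴴ * W = 1 := mem_unitaryGroup_iff'.1 hW
  set A := w • (1 : Matrix n n ℂ) - W with hA
  set B := w • (1 : Matrix n n ℂ) + W with hB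
  -- This makes `B * A⁻¹` skew-Hermitian, hence its multiple by `i` Hermitian.
  have hAB : Bᴴ * A = -(Aᴴ * B) := by
    simp only [hA, hB, conjTranspose_add, conjTranspose_sub, conjTranspose_smul,
      conjTranspose_one, add_mul, mul_sub, sub_mul, mul_add, smul_mul_assoc, mul_smul_comm,
      one_mul, mul_one, hWW, smul_add, smul_sub, smul_smul, mul_comm w, hww, one_smul]
    abel
  have hAd : IsUnit Aᴴ.det := by rw [det_conjTranspose]; exact hdet.star
  have hH : (Complex.I • (B * A⁻¹)).IsHermitian := by
    rw [IsHermitian, conjTranspose_smul, conjTranspose_mul, conjTranspose_nonsing_inv]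
    have : (Aᴴ)⁻¹ * Bᴴ = -(B * A⁻¹) := by
      calc (Aᴴ)⁻¹ * Bᴴ = (Aᴴ)⁻¹ * (Bᴴ * A) * A⁻¹ := by
            rw [mul_assoc, mul_assoc, mul_nonsing_inv _ hdet, mul_one]
        _ = _ := by
            rw [hAB, mul_neg, ← mul_assoc, nonsing_inv_mul _ hAd, one_mul, neg_mul]
    rw [this]
    simp
  set H := Complex.I • (B * A⁻¹) with hHdef
  have hHA : H * A = Complex.I • B := by
    rw [hHdef, smul_mul_assoc, mul_assoc, nonsing_inv_mul _ hdet, mul_one]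
  clear_value H
  have hspec := hH.spectral_theorem
  rw [Unitary.conjStarAlgAut_apply] at hspec
  have hY := hH.eigenvectorUnitary.2
  set Y : Matrix n n ℂ := hH.eigenvectorUnitary.1
  set d := hH.eigenvalues
  simp only [star_eq_conjTranspose] at hspec
  have hYY : Yᴴ * Y = 1 := mem_unitaryGroup_iff'.1 hY
  have hYY' : Y * Yᴴ = 1 := mem_unitaryGroup_iff.1 hY
  have hdiag : Yᴴ * W * Y =
      diagonal fun k => w * ((d k : ℂ) - Complex.I) / ((d k : ℂ) + Complex.I) := by
    -- Inverting the transform without dividing: an eigenvector basis of `H` diagonalizes `W`, with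
    -- `H + i` invertible because the eigenvalues of `H` are real.
    have h1 : (H + Complex.I • 1) * W = w • (H - Complex.I • 1) := by
      have : H * (w • 1 - W) = Complex.I • (w • 1 + W) := hHA
      rw [mul_sub, mul_smul_comm, mul_one, sub_eq_iff_eq_add] at this
      rw [smul_sub, this, add_mul, smul_mul_assoc, one_mul, smul_add, smul_comm w]
      abel
    have h2 : (diagonal (fun k => (d k : ℂ)) + Complex.I • 1) * (Yᴴ * W * Y) =
        w • (diagonal (fun k => (d k : ℂ)) - Complex.I • 1) := by
      have h3 : diagonal (fun k => (d k : ℂ)) = Yᴴ * H * Y := by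
        rw [hspec]
        simp only [← mul_assoc]
        rw [hYY, one_mul, mul_assoc, hYY, mul_one]
        rfl
      have h4 : (Yᴴ * H * Y + Complex.I • 1) = Yᴴ * (H + Complex.I • 1) * Y := by
        rw [mul_add, add_mul, mul_smul_comm, smul_mul_assoc, mul_one, hYY]
      have h5 : (Yᴴ * H * Y - Complex.I • 1) = Yᴴ * (H - Complex.I • 1) * Y := by
        rw [mul_sub, sub_mul, mul_smul_comm, smul_mul_assoc, mul_one, hYY]
      rw [h3, h4, h5]
      calc _ = Yᴴ * ((H + Complex.I • 1) * ((Y * Yᴴ) * W)) * Y := by simp only [mul_assoc]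
        _ = _ := by rw [hYY', one_mul, h1, mul_smul_comm, smul_mul_assoc]
    have hne : ∀ k, (d k : ℂ) + Complex.I ≠ 0 := fun k h => by
      simpa using congrArg Complex.im h
    ext k k'
    have h6 := congrFun (congrFun h2 k) k'
    rw [smul_one_eq_diagonal, diagonal_add, diagonal_sub, diagonal_mul, Matrix.smul_apply,
      smul_eq_mul] at h6
    rw [← mul_right_inj' (hne k), h6, diagonal_apply, diagonal_apply]
    split_ifs
    · field_simp [hne k]
    · simp
  obtain ⟨l, hl⟩ := exists_eq_phaseMatrix (hdiag ▸ mul_mem (mul_mem (Unitary.star_mem hY) hW) hY)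
  refine ⟨Y, hY, l, ?_⟩
  rw [← hl, ← hdiag]
  calc W = (Y * Yᴴ) * W * (Y * Yᴴ) := by rw [hYY', one_mul, mul_one]
    _ = _ := by simp only [mul_assoc]

end Diagonalization

/-! ### Planes spanned by two computational basis vectors. -/

section BasisFrame

variable {d : ℕ} (a : Fin 2 ↪ Fin d)

theorem basisFrame_conjTranspose_mul_self : (basisFrame a)ᴴ * basisFrame a = 1 := by
  ext s t
  simp [mul_apply, basisFrame, one_apply, apply_ite, eq_comm]

theorem basisFrame_mul_mul_conjTranspose_apply (D : Matrix (Fin 2) (Fin 2) ℂ) (k k' : Fin d) :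
    (basisFrame a * D * (basisFrame a)ᴴ) k k' =
      ∑ t, ∑ s, if k = a s ∧ k' = a t then D s t else 0 := by
  simp only [mul_apply, basisFrame, conjTranspose_apply, of_apply, Finset.sum_mul]
  refine Finset.sum_congr rfl fun t _ => Finset.sum_congr rfl fun s _ => ?_
  by_cases h : k = a s <;> by_cases h' : k' = a t <;> simp [h, h']

theorem basisFrame_mul_single_mul_conjTranspose (s : Fin 2) :
    basisFrame a * Matrix.single s s (1 : ℂ) * (basisFrame a)ᴴ = Matrix.single (a s) (a s) 1 := by
  ext k k'
  rw [basisFrame_mul_mul_conjTranspose_apply, Finset.sum_eq_single s, Finset.sum_eq_single s]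
  · simp [single_apply, eq_comm]
  · intro t _ ht
    simp [Ne.symm ht]
  · simp
  · intro t _ ht
    simp [Ne.symm ht]
  · simp

theorem basisFrame_mul_conjTranspose :
    basisFrame a * (basisFrame a)ᴴ =
      Matrix.single (a 0) (a 0) 1 + Matrix.single (a 1) (a 1) 1 := by
  have h : (1 : Matrix (Fin 2) (Fin 2) ℂ) = Matrix.single 0 0 1 + Matrix.single 1 1 1 := by
    ext i j
    fin_cases i <;> fin_cases j <;> simp
  rw [← basisFrame_mul_single_mul_conjTranspose, ← basisFrame_mul_single_mul_conjTranspose,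
    ← Matrix.add_mul, ← Matrix.mul_add, ← h, Matrix.mul_one]

end BasisFrame

/-! ### Gates active for one control state. -/

section SingleControl

variable {dA dB : ℕ}

/-- On the control state `a 0` the gate already acts as the identity, so `a 0` merely completes the
plane and disappears from the result. -/
theorem extendGate_ctrlA (a : Fin 2 ↪ Fin dA) (F : Matrix (Fin dB) (Fin 2) ℂ)
    (D : Matrix (Fin 2) (Fin 2) ℂ) :
    extendGate (basisFrame a) F (ctrlA ![1, D]) =
      ctrlA (Pi.mulSingle (a 1) (F * D * Fᴴ + (1 - F * Fᴴ))) := by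
  have hsub : Matrix.single (a 1) (a 1) (1 : ℂ) ⊗ₖ (F * D * Fᴴ + (1 - F * Fᴴ) - 1) =
      Matrix.single (a 1) (a 1) 1 ⊗ₖ (F * D * Fᴴ) - Matrix.single (a 1) (a 1) 1 ⊗ₖ (F * Fᴴ) := by
    ext x y
    simp only [kroneckerMap_apply, Matrix.add_apply, Matrix.sub_apply]
    ring
  rw [ctrlA_mulSingle, hsub, extendGate, ctrlA_eq_sum, Fin.sum_univ_two, conjTranspose_kronecker,
    Matrix.mul_add, Matrix.add_mul]
  simp only [← mul_kronecker_mul, cons_val_zero, cons_val_one, Matrix.mul_one,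
    basisFrame_mul_single_mul_conjTranspose, basisFrame_mul_conjTranspose, add_kronecker]
  abel

theorem ctrlA_mem_unitaryGroup {m n : Type*} [Fintype m] [Fintype n] [DecidableEq m]
    [DecidableEq n] {W : m → Matrix n n ℂ} (hW : ∀ i, W i ∈ unitaryGroup n ℂ) :
    ctrlA W ∈ unitaryGroup (m × n) ℂ := by
  rw [mem_unitaryGroup_iff, star_eq_conjTranspose, ctrlA_conjTranspose, ← ctrlA_mul, ← ctrlA_one]
  congr 1
  ext1 i
  exact mem_unitaryGroup_iff.1 (hW i)

/-- Two different states of the control and two different states of the target. -/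
def pairEmbedding {d : ℕ} {i j : Fin d} (h : i ≠ j) : Fin 2 ↪ Fin d :=
  ⟨![i, j], by
    intro s t
    fin_cases s <;> fin_cases t <;> simp [h, h.symm]⟩

theorem pairEmbedding_zero {d : ℕ} {i j : Fin d} (h : i ≠ j) : pairEmbedding h 0 = i := rfl

theorem pairEmbedding_one {d : ℕ} {i j : Fin d} (h : i ≠ j) : pairEmbedding h 1 = j := rfl

/-- The condition `x ≠ y` is what gives Schmidt rank two: it makes `1` and `diag(x, y)` linearly
independent. With equal phases the gate would be local. -/
theorem isStandardGate_ctrlA_mulSingle {i j : Fin dA} (hij : i ≠ j) {p q : Fin dB} (hpq : p ≠ q)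
    {x y : unitary ℂ} (hxy : x ≠ y) :
    IsStandardGate (ctrlA (Pi.mulSingle j
      (phaseMatrix (Pi.mulSingle p x * Pi.mulSingle q y)))) := by
  refine ⟨basisFrame (pairEmbedding hij), basisFrame (pairEmbedding hpq),
    ctrlA ![1, phaseMatrix ![x, y]], basisFrame_conjTranspose_mul_self _,
    basisFrame_conjTranspose_mul_self _, ctrlA_mem_unitaryGroup ?_, ?_, ?_⟩
  · intro s
    fin_cases s
    · exact one_mem _
    · exact phaseMatrix_mem_unitaryGroup _
  · refine ⟨![Matrix.single 0 0 1, Matrix.single 1 1 1], ![1, phaseMatrix ![x, y]], ?_, ?_, ?_⟩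
    · rw [LinearIndependent.pair_iff]
      intro s t h
      have h0 := congrFun (congrFun h 0) 0
      have h1 := congrFun (congrFun h 1) 1
      simp at h0 h1
      exact ⟨h0, h1⟩
    · rw [LinearIndependent.pair_iff]
      intro s t h
      have h0 := congrFun (congrFun h 0) 0
      have h1 := congrFun (congrFun h 1) 1
      simp [phaseMatrix] at h0 h1
      have ht : t = 0 := by
        have : t * ((x : ℂ) - y) = 0 := by linear_combination h0 - h1
        refine (mul_eq_zero.1 this).resolve_right fun h => hxy (Subtype.ext (sub_eq_zero.1 h))
      subst ht
      exact ⟨by simpa using h0, rfl⟩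
    · rw [ctrlA_eq_sum, Fin.sum_univ_two, Fin.sum_univ_two]
      rfl
  · rw [extendGate_ctrlA]
    congr 2
    have hF := basisFrame_mul_conjTranspose (pairEmbedding hpq)
    ext k k'
    rw [Matrix.add_apply, Matrix.sub_apply, hF, basisFrame_mul_mul_conjTranspose_apply]
    simp only [Fin.sum_univ_two, phaseMatrix, diagonal_apply, pairEmbedding_zero,
      pairEmbedding_one, one_apply, cons_val_zero, cons_val_one, Matrix.add_apply, single_apply]
    by_cases hk : k = p
    · subst hk
      by_cases hk' : k = k'
      · subst hk'; simp [hpq, hpq.symm]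
      · simp [hk', Ne.symm hk', hpq, hpq.symm]
    · by_cases hkq : k = q
      · subst hkq
        by_cases hk' : k = k'
        · subst hk'; simp [hpq, hpq.symm]
        · simp [hk', Ne.symm hk', hpq, hpq.symm]
      · by_cases hk' : k = k'
        · subst hk'; simp [hk, hkq, Ne.symm hk, Ne.symm hkq]
        · simp [hk', hk, hkq, Ne.symm hk, Ne.symm hkq]

theorem isCNOTGate_ctrlA_mulSingle {i j : Fin dA} (hij : i ≠ j) {p q : Fin dB} (hpq : p ≠ q) :
    IsCNOTGate (ctrlA (Pi.mulSingle j ((Equiv.swap p q).permMatrix ℂ))) := by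
  refine ⟨pairEmbedding hij, pairEmbedding hpq, .inl ?_⟩
  have hc : cnotA = ctrlA ![1, !![0, 1; 1, 0]] := by
    rw [ctrlA_eq_sum, Fin.sum_univ_two, cnotA]
    congr 2 <;> ext s t <;> fin_cases s <;> fin_cases t <;> simp
  rw [hc, extendGate_ctrlA]
  congr 2
  have hF := basisFrame_mul_conjTranspose (pairEmbedding hpq)
  ext k k'
  rw [Matrix.add_apply, Matrix.sub_apply, hF, basisFrame_mul_mul_conjTranspose_apply]
  simp only [Fin.sum_univ_two, pairEmbedding_zero, pairEmbedding_one, one_apply,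
    Equiv.Perm.permMatrix, PEquiv.toMatrix_toPEquiv_apply, Matrix.add_apply, single_apply]
  by_cases hk : k = p
  · subst hk
    simp [Pi.single_apply, hpq, hpq.symm, eq_comm]
  · by_cases hkq : k = q
    · subst hkq
      simp [Pi.single_apply, hpq, hpq.symm, eq_comm]
    · simp [Pi.single_apply, hk, hkq, Ne.symm hk, Ne.symm hkq, Equiv.swap_apply_of_ne_of_ne, eq_comm]

end SingleControl

/-! ### Standard gate counts for controlled unitaries. -/

section StandardCount

variable {dA dB : ℕ}

theorem phaseMatrix_mul {n : Type*} [Fintype n] [DecidableEq n] (l l' : n → unitary ℂ) :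
    phaseMatrix (l * l') = phaseMatrix l * phaseMatrix l' := by
  simp [phaseMatrix]

theorem phaseMatrix_one {n : Type*} [DecidableEq n] :
    phaseMatrix (1 : n → unitary ℂ) = 1 := by
  simp [phaseMatrix]

theorem ctrlA_mulSingle_mul {m n : Type*} [Fintype m] [Fintype n] [DecidableEq m] [DecidableEq n]
    (j : m) (T T' : Matrix n n ℂ) :
    ctrlA (Pi.mulSingle j (T * T')) = ctrlA (Pi.mulSingle j T) * ctrlA (Pi.mulSingle j T') := by
  rw [← ctrlA_mul, Pi.mulSingle_mul]

/-- Pairing distinct phases as long as possible leaves a constant family, which a global phase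
makes trivial. -/
theorem exists_isProductOfAtMost_phaseMatrix {i j : Fin dA} (hij : i ≠ j)
    (l : Fin dB → unitary ℂ) (s : Finset (Fin dB)) :
    ∃ c : unitary ℂ, IsProductOfAtMost IsStandardGate IsLocalUnitary (s.card / 2)
      (ctrlA (Pi.mulSingle j (phaseMatrix fun k => if k ∈ s then c * l k else 1))) := by
  induction s using Finset.strongInduction with
  | H s ih =>
    by_cases h : ∃ p ∈ s, ∃ q ∈ s, l p ≠ l q
    · obtain ⟨p, hp, q, hq, hl⟩ := h
      have hpq : p ≠ q := fun h => hl (h ▸ rfl)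
      have hq' : q ∈ s.erase p := Finset.mem_erase.2 ⟨hpq.symm, hq⟩
      obtain ⟨c, hc⟩ := ih ((s.erase p).erase q)
        ((Finset.erase_subset _ _).trans_ssubset (Finset.erase_ssubset hp))
      refine ⟨c, ?_⟩
      have hcard : s.card / 2 = 1 + ((s.erase p).erase q).card / 2 := by
        have := Finset.card_erase_add_one hp
        have := Finset.card_erase_add_one hq'
        omega
      have hsplit : (fun k => if k ∈ s then c * l k else 1) =
          (Pi.mulSingle p (c * l p) * Pi.mulSingle q (c * l q)) *
            fun k => if k ∈ (s.erase p).erase q then c * l k else 1 := by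
        ext1 k
        by_cases hkp : k = p
        · subst hkp; simp [hp, hpq]
        · by_cases hkq : k = q
          · subst hkq; simp [hq, hkp]
          · simp [hkp, hkq]
      rw [hsplit, phaseMatrix_mul, ctrlA_mulSingle_mul, hcard]
      exact (IsProductOfAtMost.of_gate IsLocalUnitary.one (isStandardGate_ctrlA_mulSingle hij hpq
        (by simpa using hl))).mul IsLocalUnitary.mul hc
    · push Not at h
      obtain rfl | ⟨p, hp⟩ := s.eq_empty_or_nonempty
      · refine ⟨1, .of_loc ?_⟩
        have : (fun k : Fin dB => if k ∈ (∅ : Finset (Fin dB)) then 1 * l k else 1) = 1 := by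
          ext1 k; simp
        rw [this, phaseMatrix_one, Pi.mulSingle_one, ctrlA_one]
        exact IsLocalUnitary.one
      -- All phases on `s` agree with `l p`, so this choice of `c` turns the operator into the
      -- identity.
      · refine ⟨(l p)⁻¹, .of_loc ?_⟩
        have : (fun k => if k ∈ s then (l p)⁻¹ * l k else 1) = 1 := by
          ext1 k
          by_cases hk : k ∈ s
          · simp [hk, h k hk p hp]
          · simp [hk]
        rw [this, phaseMatrix_one, Pi.mulSingle_one, ctrlA_one]
        exact IsLocalUnitary.one

theorem isProductOfAtMost_ctrlA_mulSingle {i j : Fin dA} (hij : i ≠ j)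
    {W : Matrix (Fin dB) (Fin dB) ℂ} (hW : W ∈ unitaryGroup (Fin dB) ℂ) :
    IsProductOfAtMost IsStandardGate IsLocalUnitary (dB / 2) (ctrlA (Pi.mulSingle j W)) := by
  obtain ⟨Y, hY, l, rfl⟩ := exists_unitary_diagonalization hW
  obtain ⟨c, hc⟩ := exists_isProductOfAtMost_phaseMatrix hij l Finset.univ
  -- A scalar applied for one control state only is a phase on the control party, hence local. The
  -- factor `c⁻¹` on `|j⟩` therefore undoes the rescaling by `c` at no cost.
  have hsplit : ctrlA (Pi.mulSingle j (Y * phaseMatrix l * Yᴴ)) =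
      (phaseMatrix (Pi.mulSingle j c⁻¹) ⊗ₖ Y) *
        ctrlA (Pi.mulSingle j (phaseMatrix fun k => c * l k)) * (1 ⊗ₖ Yᴴ) := by
    have h1 : phaseMatrix (Pi.mulSingle j c⁻¹) ⊗ₖ Y =
        ctrlA fun i => ((Pi.mulSingle j c⁻¹ : Fin dA → unitary ℂ) i : ℂ) • Y := by
      ext ⟨i, k⟩ ⟨i', k'⟩
      by_cases h : i = i' <;> simp [ctrlA_apply, phaseMatrix, h]
    have h2 : phaseMatrix (fun k => c * l k) = (c : ℂ) • phaseMatrix l := by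
      ext k k'
      by_cases h : k = k' <;> simp [phaseMatrix, h]
    have h3 : ((c⁻¹ : unitary ℂ) : ℂ) * c = 1 := by
      rw [← Submonoid.coe_mul, inv_mul_cancel]; rfl
    rw [h1, ← ctrlA_const, ← ctrlA_mul, ← ctrlA_mul]
    congr 1
    ext1 k
    by_cases hk : k = j
    · subst hk
      simp only [Pi.mul_apply, Pi.mulSingle_eq_same, h2, smul_mul_assoc, mul_smul_comm,
        smul_smul, mul_comm (c : ℂ), h3, one_smul]
    · simp only [Pi.mul_apply, Pi.mulSingle_eq_of_ne hk, mul_one]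
      have : Y * Yᴴ = 1 := mem_unitaryGroup_iff.1 hY
      simp [this]
  rw [hsplit]
  refine .mul_loc IsLocalUnitary.mul ⟨1, one_mem _, _, Unitary.star_mem hY, rfl⟩
    (.loc_mul IsLocalUnitary.mul ⟨_, phaseMatrix_mem_unitaryGroup _, _, hY, rfl⟩ ?_)
  simpa using hc

theorem isProductOfAtMost_ctrlA (hA : 1 ≤ dA) {W : Fin dA → Matrix (Fin dB) (Fin dB) ℂ}
    (hW : ∀ i, W i ∈ unitaryGroup (Fin dB) ℂ) :
    IsProductOfAtMost IsStandardGate IsLocalUnitary ((dA - 1) * (dB / 2)) (ctrlA W) := by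
  refine IsProductOfAtMost.ctrlA (unitaryGroup (Fin dB) ℂ).subtype hA IsLocalUnitary.mul
    (fun g => ⟨1, one_mem _, _, g.2, rfl⟩) (fun i j hij g => ?_) fun i => ⟨W i, hW i⟩
  convert isProductOfAtMost_ctrlA_mulSingle hij g.2 using 2
  ext1 k
  by_cases hk : k = j
  · subst hk; simp
  · simp [hk]

theorem isProductOfAtMost_ctrlB (hB : 1 ≤ dB) {V : Fin dB → Matrix (Fin dA) (Fin dA) ℂ}
    (hV : ∀ i, V i ∈ unitaryGroup (Fin dA) ℂ) :
    IsProductOfAtMost IsStandardGate IsLocalUnitary ((dB - 1) * (dA / 2)) (ctrlB V) := by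
  rw [← swapParties_ctrlA]
  exact (isProductOfAtMost_ctrlA hB hV).swapParties (fun _ => IsStandardGate.swapParties)
    fun _ => IsLocalUnitary.swapParties

end StandardCount

/-! ### CNOT counts for controlled permutations. -/

section CNOTCount

variable {dA dB : ℕ}

theorem isProductOfAtMost_ctrlA_mulSingle_perm {i j : Fin dA} (hij : i ≠ j)
    (σ : Equiv.Perm (Fin dB)) :
    IsProductOfAtMost IsCNOTGate IsLocalPermutation (dB - 1)
      (ctrlA (permMatrixHom (R := ℂ) ∘ Pi.mulSingle j σ)) := by
  rcases Nat.eq_zero_or_pos dB with rfl | hB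
  · obtain rfl : σ = 1 := Subsingleton.elim _ _
    rw [Pi.mulSingle_one, ctrlA_comp_one]
    exact .of_loc IsLocalPermutation.one
  let z : Fin dB := ⟨0, hB⟩
  -- Points outside `s` and different from `z` are fixed, and each transposition fixes one more
  -- point of `s`. Once all points but `z` are fixed, so is `z`, which saves one transposition.
  have key : ∀ s : Finset (Fin dB), z ∉ s → ∀ σ : Equiv.Perm (Fin dB),
      (∀ k, k ≠ z → k ∉ s → σ k = k) → IsProductOfAtMost IsCNOTGate IsLocalPermutation s.card
        (ctrlA (permMatrixHom (R := ℂ) ∘ Pi.mulSingle j σ)) := by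
    intro s
    induction s using Finset.induction_on with
    | empty =>
      intro _ σ hσ
      have hz : σ z = z := by
        by_contra h
        exact h (σ.injective (hσ _ h (by simp)))
      obtain rfl : σ = 1 := by
        ext1 k
        by_cases hk : k = z
        · rw [hk, hz]; rfl
        · exact hσ k hk (by simp)
      rw [Pi.mulSingle_one, ctrlA_comp_one]
      exact .of_loc IsLocalPermutation.one
    | insert a s ha ih =>
      intro hz σ hσ
      have hσ' := ih (fun h => hz (by simp [h])) (Equiv.swap a (σ a) * σ) fun k hkz hks => by
        by_cases hka : k = a
        · simp [hka]
        · have hk := hσ k hkz (by simp [hka, hks])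
          rw [Equiv.Perm.mul_apply, hk, Equiv.swap_apply_of_ne_of_ne hka]
          intro h
          exact hka (σ.injective (hk.trans h))
      by_cases hfix : σ a = a
      · rw [hfix, Equiv.swap_self] at hσ'
        exact IsProductOfAtMost.mono (U := ctrlA (permMatrixHom (R := ℂ) ∘ Pi.mulSingle j σ))
          hσ' (by simp [Finset.card_insert_of_notMem ha])
      · have hsplit : σ = Equiv.swap a (σ a) * (Equiv.swap a (σ a) * σ) := by
          simp
        rw [hsplit, Pi.mulSingle_mul, ctrlA_comp_mul, Finset.card_insert_of_notMem ha, add_comm]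
        refine IsProductOfAtMost.mul IsLocalPermutation.mul (.of_gate IsLocalPermutation.one ?_) hσ'
        convert isCNOTGate_ctrlA_mulSingle hij (Ne.symm hfix) using 2
        ext1 k
        by_cases hk : k = j
        · subst hk
          simp
        · simp [hk]
  have := key (Finset.univ.erase z) (by simp) σ (fun k hk hk' => absurd hk (by simpa using hk'))
  simpa [Finset.card_erase_of_mem] using this

theorem isProductOfAtMost_ctrlA_perm (hA : 1 ≤ dA) (σ : Fin dA → Equiv.Perm (Fin dB)) :
    IsProductOfAtMost IsCNOTGate IsLocalPermutation ((dA - 1) * (dB - 1))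
      (ctrlA fun i => (σ i).permMatrix ℂ) := by
  -- `permMatrix` reverses products, so the homomorphism `permMatrixHom` sends `g` to the matrix of
  -- `g⁻¹`; hence the inverse family `σ⁻¹`.
  have h := IsProductOfAtMost.ctrlA (permMatrixHom (R := ℂ)) hA IsLocalPermutation.mul
    (fun g => ⟨1, g⁻¹, by rw [permMatrix_one]; rfl⟩)
    (fun i j hij g => isProductOfAtMost_ctrlA_mulSingle_perm hij g) σ⁻¹
  convert h using 2
  ext1 k
  simp

theorem isProductOfAtMost_ctrlB_perm (hB : 1 ≤ dB) (σ : Fin dB → Equiv.Perm (Fin dA)) :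
    IsProductOfAtMost IsCNOTGate IsLocalPermutation ((dB - 1) * (dA - 1))
      (ctrlB fun i => (σ i).permMatrix ℂ) := by
  rw [← swapParties_ctrlA]
  exact (isProductOfAtMost_ctrlA_perm hB σ).swapParties (fun _ => IsCNOTGate.swapParties)
    fun _ => IsLocalPermutation.swapParties

end CNOTCount

/-! ### Edge colouring of regular bipartite multigraphs. -/

section Coloring

/-- The edges of a regular bipartite multigraph (with endpoint maps `f` and `g`) of degree `n`
have a proper coloring with `n` colors. -/
theorem exists_proper_edge_coloring {E V : Type*} [DecidableEq E] [Fintype V] [DecidableEq V]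
    (f g : E → V) (n : ℕ) (s : Finset E) (hf : ∀ v, (s.filter fun e => f e = v).card = n)
    (hg : ∀ v, (s.filter fun e => g e = v).card = n) :
    ∃ col : E → ℕ, (∀ e ∈ s, col e < n) ∧
      ∀ e ∈ s, ∀ e' ∈ s, col e = col e' → (f e = f e' ∨ g e = g e') → e = e' := by
  induction n generalizing s with
  | zero =>
    have hs : ∀ e, e ∉ s := fun e he => by
      have := Finset.card_eq_zero.1 (hf (f e))
      exact Finset.notMem_empty e (this ▸ Finset.mem_filter.2 ⟨he, rfl⟩)
    exact ⟨fun _ => 0, fun e he => absurd he (hs e), fun e he => absurd he (hs e)⟩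
  | succ n ih =>
    -- Hall's condition by double counting: the `|S| (n + 1)` edges leaving `S` all end in its
    -- neighbourhood `T`, which receives exactly `|T| (n + 1)` edges.
    have hall := (Finset.all_card_le_biUnion_card_iff_exists_injective
      fun v => (s.filter fun e => f e = v).image g).1 fun S => by
      set T := S.biUnion fun v => (s.filter fun e => f e = v).image g with hT
      have h1 : (s.filter fun e => f e ∈ S).card = S.card * (n + 1) := by
        rw [Finset.card_eq_sum_card_fiberwise (f := f) (t := S) (by intro e; simp),
          ← smul_eq_mul, ← Finset.sum_const]
        refine Finset.sum_congr rfl fun v hv => ?_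
        rw [← hf v, Finset.filter_filter]
        congr 1
        ext e
        simp only [Finset.mem_filter]
        exact ⟨fun h => ⟨h.1, h.2.2⟩, fun h => ⟨h.1, by rw [h.2]; exact hv, h.2⟩⟩
      have h2 : (s.filter fun e => g e ∈ T).card = T.card * (n + 1) := by
        rw [Finset.card_eq_sum_card_fiberwise (f := g) (t := T) (by intro e; simp),
          ← smul_eq_mul, ← Finset.sum_const]
        refine Finset.sum_congr rfl fun v hv => ?_
        rw [← hg v, Finset.filter_filter]
        congr 1
        ext e
        simp only [Finset.mem_filter]
        exact ⟨fun h => ⟨h.1, h.2.2⟩, fun h => ⟨h.1, by rw [h.2]; exact hv, h.2⟩⟩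
      have h3 : (s.filter fun e => f e ∈ S).card ≤ (s.filter fun e => g e ∈ T).card := by
        refine Finset.card_le_card fun e he => ?_
        rw [Finset.mem_filter] at he ⊢
        exact ⟨he.1, Finset.mem_biUnion.2 ⟨f e, he.2,
          Finset.mem_image_of_mem _ (Finset.mem_filter.2 ⟨he.1, rfl⟩)⟩⟩
      rw [h1, h2] at h3
      exact Nat.le_of_mul_le_mul_right h3 n.succ_pos
    obtain ⟨h, hinj, hmem⟩ := hall
    have hmem' : ∀ v, ∃ e ∈ s, f e = v ∧ g e = h v := fun v => by
      obtain ⟨e, he, heq⟩ := Finset.mem_image.1 (hmem v)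
      rw [Finset.mem_filter] at he
      exact ⟨e, he.1, he.2, heq⟩
    choose e hes hef heg using hmem'
    -- A perfect matching: removing it lowers every degree by one on both sides, and its edges
    -- receive the new colour `n`.
    set M := Finset.univ.image e with hM
    have hMmem : ∀ x, x ∈ M ↔ ∃ v, e v = x := by simp [hM]
    have hM1 : ∀ x ∈ M, ∀ v, f x = v → x = e v := by
      intro x hx v hv
      obtain ⟨w, rfl⟩ := (hMmem x).1 hx
      rw [← hv, hef]
    have hM2 : ∀ x ∈ M, ∀ v, g x = h v → x = e v := by
      intro x hx v hv
      obtain ⟨w, rfl⟩ := (hMmem x).1 hx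
      rw [heg] at hv
      rw [hinj hv]
    obtain ⟨col, hlt, hcol⟩ := ih (s \ M)
      (fun v => by
        have : ((s \ M).filter fun x => f x = v) = (s.filter fun x => f x = v).erase (e v) := by
          ext x
          simp only [Finset.mem_filter, Finset.mem_sdiff, Finset.mem_erase]
          refine ⟨fun hx => ⟨?_, hx.1.1, hx.2⟩, fun hx => ⟨⟨hx.2.1, ?_⟩, hx.2.2⟩⟩
          · rintro rfl
            exact hx.1.2 ((hMmem _).2 ⟨v, rfl⟩)
          · exact fun hxM => hx.1 (hM1 x hxM v hx.2.2)
        rw [this, Finset.card_erase_of_mem (Finset.mem_filter.2 ⟨hes v, hef v⟩), hf]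
        rfl)
      (fun w => by
        obtain ⟨v, rfl⟩ := (Finite.injective_iff_surjective.1 hinj) w
        have : ((s \ M).filter fun x => g x = h v) =
            (s.filter fun x => g x = h v).erase (e v) := by
          ext x
          simp only [Finset.mem_filter, Finset.mem_sdiff, Finset.mem_erase]
          refine ⟨fun hx => ⟨?_, hx.1.1, hx.2⟩, fun hx => ⟨⟨hx.2.1, ?_⟩, hx.2.2⟩⟩
          · rintro rfl
            exact hx.1.2 ((hMmem _).2 ⟨v, rfl⟩)
          · exact fun hxM => hx.1 (hM2 x hxM v hx.2.2)
        rw [this, Finset.card_erase_of_mem (Finset.mem_filter.2 ⟨hes v, heg v⟩), hg]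
        rfl)
    refine ⟨fun x => if x ∈ M then n else col x, fun x hx => ?_, fun x hx y hy hxy hadj => ?_⟩
    · by_cases hxM : x ∈ M
      · simp [hxM]
      · simpa [hxM] using (hlt x (Finset.mem_sdiff.2 ⟨hx, hxM⟩)).trans n.lt_succ_self
    · by_cases hxM : x ∈ M <;> by_cases hyM : y ∈ M
      · obtain ⟨v, rfl⟩ := (hMmem x).1 hxM
        rcases hadj with hadj | hadj
        · exact (hM1 y hyM v (by rw [← hadj, hef])).symm
        · exact (hM2 y hyM v (by rw [← hadj, heg])).symm
      · have := hlt y (Finset.mem_sdiff.2 ⟨hy, hyM⟩)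
        simp only [hxM, hyM, if_true, if_false] at hxy
        omega
      · have := hlt x (Finset.mem_sdiff.2 ⟨hx, hxM⟩)
        simp only [hxM, hyM, if_true, if_false] at hxy
        omega
      · simp only [hxM, hyM, if_false] at hxy
        exact hcol x (Finset.mem_sdiff.2 ⟨hx, hxM⟩) y (Finset.mem_sdiff.2 ⟨hy, hyM⟩) hxy hadj

end Coloring

/-! ### Permutations of the product basis. -/

section Grid

variable {dA dB : ℕ}

/-- A permutation of a grid permutes within the rows, then within the columns, then within the
rows again. -/
theorem exists_row_column_row_decomposition (σ : Equiv.Perm (Fin dA × Fin dB)) :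
    ∃ (α : Fin dA → Equiv.Perm (Fin dB)) (β : Fin dB → Equiv.Perm (Fin dA))
      (γ : Fin dA → Equiv.Perm (Fin dB)),
      σ = Equiv.prodCongrRight γ * Equiv.prodCongrLeft β * Equiv.prodCongrRight α := by
  have hrow : ∀ a : Fin dA, (Finset.univ.filter fun e : Fin dA × Fin dB => e.1 = a).card = dB := by
    intro a
    have : (Finset.univ.filter fun e : Fin dA × Fin dB => e.1 = a) = {a} ×ˢ Finset.univ := by
      ext ⟨x, y⟩
      simp [eq_comm]
    rw [this]
    simp
  -- The colour of a cell is its intermediate column. Properness at source rows makes each `α a`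
  -- injective; properness at target rows makes each `β c` injective.
  obtain ⟨col, hlt, hcol⟩ := exists_proper_edge_coloring
    (fun e : Fin dA × Fin dB => e.1) (fun e => (σ e).1) dB Finset.univ hrow fun a => by
      exact (Finset.card_equiv σ (by simp)).trans (hrow a)
  let α : Fin dA → Equiv.Perm (Fin dB) := fun a =>
    Equiv.ofBijective (fun b => ⟨col (a, b), hlt _ (Finset.mem_univ _)⟩)
      (Finite.injective_iff_bijective.1 fun b b' h => by
        simpa using hcol (a, b) (Finset.mem_univ _) (a, b') (Finset.mem_univ _)
          (congrArg Fin.val h) (.inl rfl))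
  have hα : ∀ a c, col (a, (α a).symm c) = c := fun a c =>
    congrArg Fin.val ((α a).apply_symm_apply c)
  let β : Fin dB → Equiv.Perm (Fin dA) := fun c =>
    Equiv.ofBijective (fun a => (σ (a, (α a).symm c)).1)
      (Finite.injective_iff_bijective.1 fun a a' h =>
        congrArg Prod.fst (hcol (a, (α a).symm c) (Finset.mem_univ _) (a', (α a').symm c)
          (Finset.mem_univ _) (by rw [hα, hα]) (.inr h)))
  have hβ : ∀ a' c, (σ ((β c).symm a', (α ((β c).symm a')).symm c)).1 = a' := fun a' c =>
    (β c).apply_symm_apply a'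
  let γ : Fin dA → Equiv.Perm (Fin dB) := fun a' =>
    Equiv.ofBijective (fun c => (σ ((β c).symm a', (α ((β c).symm a')).symm c)).2)
      (Finite.injective_iff_bijective.1 fun c c' h => by
        have h' := σ.injective (Prod.ext ((hβ a' c).trans (hβ a' c').symm) h)
        have := congrArg col h'
        rw [hα, hα] at this
        exact Fin.ext this)
  refine ⟨α, β, γ, Equiv.ext fun ⟨a, b⟩ => ?_⟩
  have h1 : β (α a b) a = (σ (a, b)).1 := by
    change (σ (a, (α a).symm (α a b))).1 = _
    rw [Equiv.symm_apply_apply]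
  have h2 : γ (β (α a b) a) (α a b) = (σ (a, b)).2 := by
    change (σ ((β (α a b)).symm (β (α a b) a),
      (α ((β (α a b)).symm (β (α a b) a))).symm (α a b))).2 = _
    rw [Equiv.symm_apply_apply, Equiv.symm_apply_apply]
  exact Prod.ext h1.symm h2.symm

theorem permMatrix_prodCongrRight (α : Fin dA → Equiv.Perm (Fin dB)) :
    Equiv.Perm.permMatrix ℂ (Equiv.prodCongrRight α) = ctrlA fun a => (α a).permMatrix ℂ := by
  ext ⟨a, b⟩ ⟨a', b'⟩
  by_cases h : a = a' <;>
    simp [ctrlA_apply, Equiv.Perm.permMatrix, PEquiv.toMatrix_apply, h]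

theorem permMatrix_prodCongrLeft (β : Fin dB → Equiv.Perm (Fin dA)) :
    Equiv.Perm.permMatrix ℂ (Equiv.prodCongrLeft β) = ctrlB fun b => (β b).permMatrix ℂ := by
  ext ⟨a, b⟩ ⟨a', b'⟩
  by_cases h : b = b' <;>
    simp [ctrlB_apply, Equiv.Perm.permMatrix, PEquiv.toMatrix_apply, h]

theorem exists_permMatrix_eq_ctrlA_mul_ctrlB_mul_ctrlA (σ : Equiv.Perm (Fin dA × Fin dB)) :
    ∃ (α : Fin dA → Equiv.Perm (Fin dB)) (β : Fin dB → Equiv.Perm (Fin dA))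
      (γ : Fin dA → Equiv.Perm (Fin dB)),
      σ.permMatrix ℂ = ctrlA (fun a => (α a).permMatrix ℂ) *
        ctrlB (fun b => (β b).permMatrix ℂ) * ctrlA fun a => (γ a).permMatrix ℂ := by
  obtain ⟨α, β, γ, h⟩ := exists_row_column_row_decomposition σ
  refine ⟨α, β, γ, ?_⟩
  -- Since `permMatrix` reverses products, `α`, which acts first, becomes the leftmost matrix
  -- factor.
  rw [h, permMatrix_mul, permMatrix_mul, permMatrix_prodCongrRight, permMatrix_prodCongrRight,
    permMatrix_prodCongrLeft, mul_assoc]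

theorem permMatrix_mem_unitaryGroup {n : Type*} [Fintype n] [DecidableEq n] (σ : Equiv.Perm n) :
    σ.permMatrix ℂ ∈ unitaryGroup n ℂ := by
  rw [mem_unitaryGroup_iff, star_eq_conjTranspose, conjTranspose_permMatrix, ← permMatrix_mul]
  simp

theorem IsComplexPermutation.exists_eq_phaseMatrix_mul_permMatrix {U : BipartiteMatrix dA dB}
    (hU : IsComplexPermutation U) :
    ∃ (l : Fin dA × Fin dB → unitary ℂ) (σ : Equiv.Perm (Fin dA × Fin dB)),
      U = phaseMatrix l * σ.permMatrix ℂ := by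
  obtain ⟨hunit, hrow, hcol⟩ := hU
  choose f hf hf' using hrow
  have hinj : Function.Injective f := fun i i' h =>
    (hcol (f i)).unique (hf i) (by simpa [h] using hf i')
  let σ : Equiv.Perm (Fin dA × Fin dB) := Equiv.ofBijective f (Finite.injective_iff_bijective.1 hinj)
  obtain ⟨d, hd⟩ : ∃ d, d = fun i => U i (f i) := ⟨_, rfl⟩
  have hUσ : U = diagonal d * σ.permMatrix ℂ := by
    ext i j
    rw [diagonal_mul, Equiv.Perm.permMatrix, PEquiv.toMatrix_toPEquiv_apply]
    by_cases h : f i = j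
    · subst h
      simp [σ, hd]
    · have : U i j = 0 := by
        by_contra h0
        exact h (hf' i j h0).symm
      simp [σ, this, Ne.symm h]
  -- The diagonal factor is thus unitary, so the nonzero entries of `U` are phases.
  have hdiag : diagonal d = U * (σ.permMatrix ℂ)ᴴ := by
    have h1 : σ.permMatrix ℂ * (σ.permMatrix ℂ)ᴴ = 1 :=
      mem_unitaryGroup_iff.1 (permMatrix_mem_unitaryGroup σ)
    rw [hUσ, mul_assoc, h1, mul_one]
  obtain ⟨l, hl⟩ := exists_eq_phaseMatrix (hdiag ▸
    mul_mem hunit (Unitary.star_mem (permMatrix_mem_unitaryGroup σ)))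
  exact ⟨l, σ, hl ▸ hUσ⟩

theorem phaseMatrix_eq_ctrlA (l : Fin dA × Fin dB → unitary ℂ) :
    phaseMatrix l = ctrlA fun a => phaseMatrix fun b => l (a, b) := by
  ext ⟨a, b⟩ ⟨a', b'⟩
  by_cases h : a = a' <;> simp [ctrlA_apply, phaseMatrix, diagonal_apply, h]

theorem IsComplexPermutation.isProductOfAtMost (hA : 1 ≤ dA) (hB : 1 ≤ dB)
    {U : BipartiteMatrix dA dB} (hU : IsComplexPermutation U) :
    IsProductOfAtMost IsStandardGate IsLocalUnitary
      (2 * (dA - 1) * (dB / 2) + (dB - 1) * (dA / 2)) U := by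
  obtain ⟨l, σ, rfl⟩ := hU.exists_eq_phaseMatrix_mul_permMatrix
  obtain ⟨α, β, γ, h⟩ := exists_permMatrix_eq_ctrlA_mul_ctrlB_mul_ctrlA σ
  -- The diagonal of phases is itself controlled by the first party and merges into the leftmost
  -- controlled factor.
  rw [h, phaseMatrix_eq_ctrlA, ← mul_assoc, ← mul_assoc, ← ctrlA_mul]
  refine (((isProductOfAtMost_ctrlA hA fun a => ?_).mul IsLocalUnitary.mul
    (isProductOfAtMost_ctrlB hB fun b => ?_)).mul IsLocalUnitary.mul
    (isProductOfAtMost_ctrlA hA fun a => ?_)).mono (le_of_eq (by ring))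
  · exact mul_mem (phaseMatrix_mem_unitaryGroup _) (permMatrix_mem_unitaryGroup _)
  · exact permMatrix_mem_unitaryGroup _
  · exact permMatrix_mem_unitaryGroup _

theorem isProductOfAtMost_permMatrix (hA : 1 ≤ dA) (hB : 1 ≤ dB)
    (σ : Equiv.Perm (Fin dA × Fin dB)) :
    IsProductOfAtMost IsCNOTGate IsLocalPermutation (3 * (dA - 1) * (dB - 1))
      (σ.permMatrix ℂ) := by
  obtain ⟨α, β, γ, h⟩ := exists_permMatrix_eq_ctrlA_mul_ctrlB_mul_ctrlA σ
  rw [h]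
  exact (((isProductOfAtMost_ctrlA_perm hA α).mul IsLocalPermutation.mul
    (isProductOfAtMost_ctrlB_perm hB β)).mul IsLocalPermutation.mul
    (isProductOfAtMost_ctrlA_perm hA γ)).mono (le_of_eq (by ring))

end Grid

/-! ### Gram matrices and singular values. -/

section GramMatrix

variable {p q : Type*} [Fintype p] [Fintype q] [DecidableEq p] [DecidableEq q]

/-- Matrices with the same Gram matrix differ by a unitary. -/
theorem exists_unitary_mul_eq {A B : Matrix p q ℂ} (h : Aᴴ * A = Bᴴ * B) :
    ∃ W ∈ unitaryGroup p ℂ, A = W * B := by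
  have hnorm : ∀ x, ‖toEuclideanLin A x‖ = ‖toEuclideanLin B x‖ := fun x => by
    have key : ∀ M : Matrix p q ℂ, inner ℂ (toEuclideanLin M x) (toEuclideanLin M x) =
        inner ℂ x (toEuclideanLin (Mᴴ * M) x) := fun M => by
      rw [toLpLin_mul_same, toEuclideanLin_conjTranspose_eq_adjoint, LinearMap.comp_apply,
        LinearMap.adjoint_inner_right]
    have h2 := (key A).trans ((congrArg (fun M => inner ℂ x (toEuclideanLin M x)) h).trans
      (key B).symm)
    rw [inner_self_eq_norm_sq_to_K, inner_self_eq_norm_sq_to_K] at h2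
    have h3 : ‖toEuclideanLin A x‖ ^ 2 = ‖toEuclideanLin B x‖ ^ 2 := by exact_mod_cast h2
    exact (pow_left_inj₀ (norm_nonneg _) (norm_nonneg _) two_ne_zero).1 h3
  have hker : LinearMap.ker (toEuclideanLin B) ≤ LinearMap.ker (toEuclideanLin A) := fun x hx => by
    rw [LinearMap.mem_ker] at hx ⊢
    rw [← norm_eq_zero, hnorm, hx, norm_zero]
  -- The map `B x ↦ A x` on the range of `B` is well defined and isometric; in finite dimension it
  -- extends to an isometry of the whole space, which is `W`.
  let T := (LinearMap.ker (toEuclideanLin B)).liftQ (toEuclideanLin A) hker ∘ₗ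
    (toEuclideanLin B).quotKerEquivRange.symm.toLinearMap
  have hT : ∀ x, T ⟨toEuclideanLin B x, LinearMap.mem_range_self _ x⟩ = toEuclideanLin A x :=
    fun x => by
      simp only [T, LinearMap.comp_apply, LinearEquiv.coe_coe]
      rw [LinearMap.quotKerEquivRange_symm_apply_image]
      simp
  let L : LinearMap.range (toEuclideanLin B) →ₗᵢ[ℂ] EuclideanSpace ℂ p :=
    ⟨T, by
      rintro ⟨_, x, rfl⟩
      rw [hT]
      exact hnorm x⟩
  have hL : ∀ x, L.extend (toEuclideanLin B x) = toEuclideanLin A x := fun x => by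
    rw [← hT x]
    exact L.extend_apply ⟨toEuclideanLin B x, LinearMap.mem_range_self _ x⟩
  have hW : toEuclideanLin (toEuclideanLin.symm L.extend.toLinearMap) = L.extend.toLinearMap :=
    LinearEquiv.apply_symm_apply _ _
  refine ⟨toEuclideanLin.symm L.extend.toLinearMap, ?_, ?_⟩
  · rw [mem_unitaryGroup_iff', star_eq_conjTranspose]
    apply toEuclideanLin.injective
    rw [toLpLin_mul_same, toEuclideanLin_conjTranspose_eq_adjoint, hW, toLpLin_one]
    ext1 x
    refine ext_inner_left ℂ fun y => ?_
    rw [LinearMap.comp_apply, LinearMap.adjoint_inner_right]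
    exact L.extend.inner_map_map y x
  · apply toEuclideanLin.injective
    rw [toLpLin_mul_same, hW]
    ext1 x
    exact (hL x).symm

open scoped ComplexOrder in
/-- Singular value decomposition of square matrices. -/
theorem exists_singular_value_decomposition (X : Matrix q q ℂ) :
    ∃ Y ∈ unitaryGroup q ℂ, ∃ Z ∈ unitaryGroup q ℂ, ∃ c : q → ℝ, (∀ j, 0 ≤ c j) ∧
      X = Y * diagonal (fun j => (c j : ℂ)) * Z := by
  have hps := posSemidef_conjTranspose_mul_self X
  have hspec := hps.isHermitian.spectral_theorem
  rw [Unitary.conjStarAlgAut_apply] at hspec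
  have hV := hps.isHermitian.eigenvectorUnitary.2
  set V : Matrix q q ℂ := hps.isHermitian.eigenvectorUnitary.1
  set d := hps.isHermitian.eigenvalues
  have hd : ∀ j, 0 ≤ d j := hps.eigenvalues_nonneg
  have hVV : Vᴴ * V = 1 := mem_unitaryGroup_iff'.1 hV
  have hVV' : V * Vᴴ = 1 := mem_unitaryGroup_iff.1 hV
  obtain ⟨Y, hY, hXY⟩ := exists_unitary_mul_eq (A := X * V)
    (B := diagonal fun j => (Real.sqrt (d j) : ℂ)) (by
      rw [conjTranspose_mul, diagonal_conjTranspose, diagonal_mul_diagonal]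
      calc Vᴴ * Xᴴ * (X * V) = Vᴴ * (Xᴴ * X) * V := by simp only [mul_assoc]
        _ = (Vᴴ * V) * diagonal (fun j => (d j : ℂ)) * (Vᴴ * V) := by
            rw [hspec]
            simp only [mul_assoc]
            rfl
        _ = _ := by
            rw [hVV, one_mul, mul_one]
            congr 1
            ext1 j
            simp only [Pi.star_apply, Complex.star_def, Complex.conj_ofReal]
            rw [← Complex.ofReal_mul, Real.mul_self_sqrt (hd j)])
  refine ⟨Y, hY, Vᴴ, Unitary.star_mem hV, fun j => Real.sqrt (d j), fun j => Real.sqrt_nonneg _, ?_⟩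
  rw [← hXY, mul_assoc, hVV', mul_one]

end GramMatrix

/-! ### Cosine-sine decomposition. -/

section CosineSine

variable {p q : Type*} [Fintype p] [Fintype q] [DecidableEq p] [DecidableEq q]

theorem fromBlocks_diag_mem_unitaryGroup {W : Matrix p p ℂ} {Y : Matrix q q ℂ}
    (hW : W ∈ unitaryGroup p ℂ) (hY : Y ∈ unitaryGroup q ℂ) :
    fromBlocks W 0 0 Y ∈ unitaryGroup (p ⊕ q) ℂ := by
  rw [mem_unitaryGroup_iff, star_eq_conjTranspose] at *
  simp [fromBlocks_conjTranspose, fromBlocks_multiply, hW, hY]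

/-- Unitaries with the same lower right corner agree up to unitaries on the complement of that
corner. -/
theorem exists_eq_mul_mul_of_corner_eq {U₁₁ M₁₁ : Matrix p p ℂ} {U₁₂ M₁₂ : Matrix p q ℂ}
    {U₂₁ M₂₁ : Matrix q p ℂ} {C : Matrix q q ℂ}
    (hU : fromBlocks U₁₁ U₁₂ U₂₁ C ∈ unitaryGroup (p ⊕ q) ℂ)
    (hM : fromBlocks M₁₁ M₁₂ M₂₁ C ∈ unitaryGroup (p ⊕ q) ℂ) :
    ∃ W ∈ unitaryGroup p ℂ, ∃ V ∈ unitaryGroup p ℂ, fromBlocks U₁₁ U₁₂ U₂₁ C =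
      fromBlocks W 0 0 1 * fromBlocks M₁₁ M₁₂ M₂₁ C * fromBlocks V 0 0 1 := by
  have hU' := mem_unitaryGroup_iff'.1 hU
  have hM' := mem_unitaryGroup_iff'.1 hM
  rw [star_eq_conjTranspose, fromBlocks_conjTranspose, fromBlocks_multiply, ← fromBlocks_one,
    fromBlocks_inj] at hU' hM'
  -- Unitarity of the last block column gives both upper blocks the Gram matrix `1 - Cᴴ C`.
  obtain ⟨W, hW, hUW⟩ := exists_unitary_mul_eq (add_right_cancel (hU'.2.2.2.trans hM'.2.2.2.symm))
  have hWW : Wᴴ * W = 1 := mem_unitaryGroup_iff'.1 hW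
  have hWW' : W * Wᴴ = 1 := mem_unitaryGroup_iff.1 hW
  set M := fromBlocks M₁₁ M₁₂ M₂₁ C with hMdef
  set U := fromBlocks U₁₁ U₁₂ U₂₁ C with hUdef
  have hD := fromBlocks_diag_mem_unitaryGroup hW (one_mem (unitaryGroup q ℂ))
  -- After the correction by `W` the last block columns of `U` and `M` coincide, so `N` fixes the
  -- corner's basis vectors; being unitary, it is block diagonal.
  obtain ⟨N, hN⟩ : ∃ N, N = Mᴴ * (fromBlocks Wᴴ 0 0 1 * U) := ⟨_, rfl⟩
  have hDH : fromBlocks Wᴴ 0 0 (1 : Matrix q q ℂ) = (fromBlocks W 0 0 1)ᴴ := by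
    simp [fromBlocks_conjTranspose]
  have hNu : N ∈ unitaryGroup (p ⊕ q) ℂ := by
    rw [hN, hDH]
    exact mul_mem (Unitary.star_mem hM) (mul_mem (Unitary.star_mem hD) hU)
  have hNblocks : N = fromBlocks N.toBlocks₁₁ 0 N.toBlocks₂₁ 1 := by
    have h : N.toBlocks₁₂ = 0 ∧ N.toBlocks₂₂ = 1 := by
      have h1 : Wᴴ * U₁₂ = M₁₂ := by
        rw [hUW, ← Matrix.mul_assoc, hWW, Matrix.one_mul]
      rw [hN, hMdef, hUdef, fromBlocks_conjTranspose, fromBlocks_multiply, fromBlocks_multiply,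
        toBlocks_fromBlocks₁₂, toBlocks_fromBlocks₂₂]
      simp only [Matrix.zero_mul, add_zero, zero_add, Matrix.one_mul, h1]
      exact ⟨hM'.2.1, hM'.2.2.2⟩
    conv_lhs => rw [← fromBlocks_toBlocks N, h.1, h.2]
  have hNN := mem_unitaryGroup_iff'.1 hNu
  rw [hNblocks, star_eq_conjTranspose, fromBlocks_conjTranspose, fromBlocks_multiply,
    ← fromBlocks_one, fromBlocks_inj] at hNN
  have hN21 : N.toBlocks₂₁ = 0 := by simpa using hNN.2.2.1
  have hN11 : (N.toBlocks₁₁)ᴴ * N.toBlocks₁₁ = 1 := by simpa [hN21] using hNN.1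
  refine ⟨W, hW, N.toBlocks₁₁, mem_unitaryGroup_iff'.2 hN11, ?_⟩
  rw [hN21] at hNblocks
  rw [← hNblocks, hN]
  have hMM : M * Mᴴ = 1 := mem_unitaryGroup_iff.1 hM
  have hDD : fromBlocks W 0 0 (1 : Matrix q q ℂ) * fromBlocks Wᴴ 0 0 1 = 1 := by
    rw [hDH]
    exact mem_unitaryGroup_iff.1 hD
  calc U = (fromBlocks W 0 0 1 * ((M * Mᴴ) * fromBlocks Wᴴ 0 0 1)) * U := by
        rw [hMM, one_mul, hDD, one_mul]
    _ = _ := by simp only [mul_assoc]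

/-- A decomposition of cosine-sine type, with a prescribed family of unitary middle factors. -/
theorem exists_cosine_sine_decomposition {U : Matrix (p ⊕ q) (p ⊕ q) ℂ}
    (hU : U ∈ unitaryGroup (p ⊕ q) ℂ) {P : Matrix (p ⊕ q) (p ⊕ q) ℂ → Prop}
    (hP : ∀ c : q → ℝ, (∀ j, 0 ≤ c j) → (∀ j, c j ≤ 1) →
      ∃ M ∈ unitaryGroup (p ⊕ q) ℂ, M.toBlocks₂₂ = diagonal (fun j => (c j : ℂ)) ∧ P M) :
    ∃ W ∈ unitaryGroup p ℂ, ∃ Y ∈ unitaryGroup q ℂ, ∃ M, P M ∧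
      ∃ V ∈ unitaryGroup p ℂ, ∃ Z ∈ unitaryGroup q ℂ,
        U = fromBlocks W 0 0 Y * M * fromBlocks V 0 0 Z := by
  obtain ⟨Y, hY, Z, hZ, c, hc0, hX⟩ := exists_singular_value_decomposition U.toBlocks₂₂
  have hYY : Yᴴ * Y = 1 := mem_unitaryGroup_iff'.1 hY
  have hYY' : Y * Yᴴ = 1 := mem_unitaryGroup_iff.1 hY
  have hZZ : Zᴴ * Z = 1 := mem_unitaryGroup_iff'.1 hZ
  have hZZ' : Z * Zᴴ = 1 := mem_unitaryGroup_iff.1 hZ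
  have hU' : fromBlocks 1 0 0 Yᴴ * U * fromBlocks 1 0 0 Zᴴ ∈ unitaryGroup (p ⊕ q) ℂ :=
    mul_mem (mul_mem (fromBlocks_diag_mem_unitaryGroup (one_mem _) (Unitary.star_mem hY)) hU)
      (fromBlocks_diag_mem_unitaryGroup (one_mem _) (Unitary.star_mem hZ))
  have hblocks : fromBlocks 1 0 0 Yᴴ * U * fromBlocks 1 0 0 Zᴴ =
      fromBlocks U.toBlocks₁₁ (U.toBlocks₁₂ * Zᴴ) (Yᴴ * U.toBlocks₂₁)
        (diagonal fun j => (c j : ℂ)) := by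
    conv_lhs => rw [← fromBlocks_toBlocks U, hX]
    simp only [fromBlocks_multiply, Matrix.zero_mul, Matrix.mul_zero, add_zero, zero_add,
      Matrix.one_mul, Matrix.mul_one]
    congr 1
    calc _ = (Yᴴ * Y) * diagonal (fun j => (c j : ℂ)) * (Z * Zᴴ) := by simp only [mul_assoc]
      _ = _ := by rw [hYY, hZZ', one_mul, mul_one]
  rw [hblocks] at hU'
  have hc1 : ∀ j, c j ≤ 1 := fun j => by
    have h := mem_unitaryGroup_iff'.1 hU'
    rw [star_eq_conjTranspose, fromBlocks_conjTranspose, fromBlocks_multiply, ← fromBlocks_one,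
      fromBlocks_inj] at h
    have h22 := congrArg Complex.re (congrFun (congrFun h.2.2.2 j) j)
    rw [diagonal_conjTranspose, diagonal_mul_diagonal, Matrix.add_apply, diagonal_apply_eq,
      one_apply_eq, mul_apply, Complex.add_re, Complex.re_sum] at h22
    have hnonneg : 0 ≤ ∑ i, ((U.toBlocks₁₂ * Zᴴ)ᴴ j i * (U.toBlocks₁₂ * Zᴴ) i j).re := by
      refine Finset.sum_nonneg fun i _ => ?_
      rw [conjTranspose_apply, Complex.star_def, ← Complex.normSq_eq_conj_mul_self,
        Complex.ofReal_re]
      exact Complex.normSq_nonneg _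
    simp only [Pi.star_apply, Complex.star_def, Complex.conj_ofReal, ← Complex.ofReal_mul,
      Complex.ofReal_re, Complex.one_re] at h22
    nlinarith
  obtain ⟨M, hM, hM22, hPM⟩ := hP c hc0 hc1
  have hM' := hM
  rw [← fromBlocks_toBlocks M, hM22] at hM'
  obtain ⟨W, hW, V, hV, h⟩ := exists_eq_mul_mul_of_corner_eq hU' hM'
  rw [← hM22, fromBlocks_toBlocks, hM22, ← hblocks] at h
  refine ⟨W, hW, Y, hY, M, hPM, V, hV, Z, hZ, ?_⟩
  have h1 : fromBlocks W 0 0 Y = fromBlocks 1 0 0 Y * fromBlocks W 0 0 (1 : Matrix q q ℂ) := by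
    simp [fromBlocks_multiply]
  have h2 : fromBlocks V 0 0 Z = fromBlocks V 0 0 (1 : Matrix q q ℂ) * fromBlocks 1 0 0 Z := by
    simp [fromBlocks_multiply]
  have hY1 : fromBlocks (1 : Matrix p p ℂ) 0 0 Y * fromBlocks 1 0 0 Yᴴ = 1 := by
    simp [fromBlocks_multiply, hYY']
  have hZ1 : fromBlocks (1 : Matrix p p ℂ) 0 0 Zᴴ * fromBlocks 1 0 0 Z = 1 := by
    simp [fromBlocks_multiply, hZZ]
  calc U = (fromBlocks 1 0 0 Y * fromBlocks 1 0 0 Yᴴ) * U *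
        (fromBlocks 1 0 0 Zᴴ * fromBlocks 1 0 0 Z) := by rw [hY1, hZ1, one_mul, mul_one]
    _ = fromBlocks 1 0 0 Y * (fromBlocks 1 0 0 Yᴴ * U * fromBlocks 1 0 0 Zᴴ) *
        fromBlocks 1 0 0 Z := by simp only [mul_assoc]
    _ = _ := by
      rw [h, h1, h2]
      simp only [mul_assoc]

/-- Rotations in the planes spanned by `e j` and `j`, with prescribed cosines. -/
theorem exists_unitary_corner_eq_diagonal (e : q ↪ p) {c : q → ℝ} (h0 : ∀ j, 0 ≤ c j)
    (h1 : ∀ j, c j ≤ 1) :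
    ∃ V ∈ unitaryGroup (p ⊕ q) ℂ, V.toBlocks₂₂ = diagonal fun j => (c j : ℂ) := by
  obtain ⟨C, hC⟩ : ∃ C : Matrix q q ℂ, C = diagonal fun j => (c j : ℂ) := ⟨_, rfl⟩
  obtain ⟨S, hS⟩ : ∃ S : Matrix q q ℂ, S = diagonal fun j => (Real.sqrt (1 - c j ^ 2) : ℂ) :=
    ⟨_, rfl⟩
  obtain ⟨J, hJ⟩ : ∃ J : Matrix p q ℂ, J = of fun i j => if i = e j then 1 else 0 := ⟨_, rfl⟩
  have hJJ : Jᴴ * J = 1 := by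
    ext j k
    simp [hJ, mul_apply, one_apply, apply_ite, eq_comm]
  have hCC : Cᴴ = C := by
    rw [hC, diagonal_conjTranspose]
    congr 1
    ext1 j
    simp
  have hSS : Sᴴ = S := by
    rw [hS, diagonal_conjTranspose]
    congr 1
    ext1 j
    simp
  have hCS : C * S = S * C := by
    rw [hC, hS, diagonal_mul_diagonal, diagonal_mul_diagonal]
    simp only [mul_comm]
  have hsum : C * C + S * S = 1 := by
    rw [hC, hS, diagonal_mul_diagonal, diagonal_mul_diagonal, diagonal_add, ← diagonal_one]
    congr 1
    ext1 j
    rw [← Complex.ofReal_mul, ← Complex.ofReal_mul, ← Complex.ofReal_add,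
      Real.mul_self_sqrt (by nlinarith [h0 j, h1 j])]
    norm_num
    ring
  have hconj : ∀ X Y : Matrix q q ℂ, (J * X * Jᴴ) * (J * Y * Jᴴ) = J * (X * Y) * Jᴴ := by
    intro X Y
    calc _ = J * X * ((Jᴴ * J) * (Y * Jᴴ)) := by simp only [Matrix.mul_assoc]
      _ = _ := by rw [hJJ, Matrix.one_mul]; simp only [Matrix.mul_assoc]
  -- `J` is the isometry given by `e`; the upper left block is `C` on its range and the identity on
  -- the complement.
  refine ⟨fromBlocks (1 - J * (1 - C) * Jᴴ) (J * S) (-(S * Jᴴ)) C, ?_, by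
    rw [toBlocks_fromBlocks₂₂, hC]⟩
  rw [mem_unitaryGroup_iff, star_eq_conjTranspose, fromBlocks_conjTranspose, fromBlocks_multiply,
    ← fromBlocks_one, fromBlocks_inj]
  have hH : (1 - J * (1 - C) * Jᴴ)ᴴ = 1 - J * (1 - C) * Jᴴ := by
    simp [conjTranspose_mul, hCC, Matrix.mul_assoc]
  have hJS : (J * S)ᴴ = S * Jᴴ := by rw [conjTranspose_mul, hSS]
  have hSJ : (-(S * Jᴴ))ᴴ = -(J * S) := by
    rw [conjTranspose_neg, conjTranspose_mul, hSS, conjTranspose_conjTranspose]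
  rw [hH, hJS, hSJ, hCC]
  have hoff : J * (1 - C) * Jᴴ * (J * S) = J * S - J * (S * C) := by
    calc _ = J * ((1 - C) * ((Jᴴ * J) * S)) := by simp only [Matrix.mul_assoc]
      _ = _ := by rw [hJJ, one_mul, sub_mul, one_mul, hCS, Matrix.mul_sub]
  have hoff' : S * Jᴴ * (J * (1 - C) * Jᴴ) = S * Jᴴ - S * C * Jᴴ := by
    calc _ = S * ((Jᴴ * J) * (1 - C)) * Jᴴ := by simp only [Matrix.mul_assoc]
      _ = _ := by rw [hJJ, one_mul, mul_sub, mul_one, Matrix.sub_mul]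
  refine ⟨?_, ?_, ?_, ?_⟩
  · have hsq : (1 - C) * (1 - C) + S * S = (1 - C) + (1 - C) := by
      have : S * S = 1 - C * C := by rw [← hsum]; abel
      rw [this]
      noncomm_ring
    have hJSSJ : J * S * (S * Jᴴ) = J * (S * S) * Jᴴ := by simp only [Matrix.mul_assoc]
    have := congrArg (fun X => J * X * Jᴴ) hsq
    simp only [Matrix.mul_add, Matrix.add_mul] at this
    rw [← hconj] at this
    have hexp : ∀ X : Matrix p p ℂ, (1 - X) * (1 - X) = 1 - (X + X) + X * X := fun X => by
      noncomm_ring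
    rw [hJSSJ, hexp, ← this]
    abel
  · rw [Matrix.mul_neg, Matrix.sub_mul, Matrix.one_mul, hoff, Matrix.mul_assoc]
    abel
  · rw [Matrix.neg_mul, Matrix.mul_sub, Matrix.mul_one, hoff', ← Matrix.mul_assoc, hCS]
    abel
  · rw [Matrix.neg_mul, Matrix.mul_neg, neg_neg]
    calc _ = S * ((Jᴴ * J) * S) + C * C := by simp only [Matrix.mul_assoc]
      _ = _ := by rw [hJJ, one_mul, add_comm, hsum]

end CosineSine

/-! ### Recursive splitting of the first party. -/

section Alternating

variable {m m₁ m₂ n : Type*}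

/-- The direct sum of operators with respect to a decomposition of the first party. -/
def directSumA (U₁ : Matrix (m₁ × n) (m₁ × n) ℂ) (U₂ : Matrix (m₂ × n) (m₂ × n) ℂ) :
    Matrix ((m₁ ⊕ m₂) × n) ((m₁ ⊕ m₂) × n) ℂ :=
  (fromBlocks U₁ 0 0 U₂).submatrix (Equiv.sumProdDistrib m₁ m₂ n) (Equiv.sumProdDistrib m₁ m₂ n)

theorem directSumA_mul [Fintype m₁] [Fintype m₂] [Fintype n] (U₁ U₁' : Matrix (m₁ × n) (m₁ × n) ℂ)
    (U₂ U₂' : Matrix (m₂ × n) (m₂ × n) ℂ) :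
    directSumA (U₁ * U₁') (U₂ * U₂') = directSumA U₁ U₂ * directSumA U₁' U₂' := by
  rw [directSumA, directSumA, directSumA, submatrix_mul_equiv, fromBlocks_multiply]
  simp

theorem directSumA_ctrlA [DecidableEq m₁] [DecidableEq m₂] (W₁ : m₁ → Matrix n n ℂ)
    (W₂ : m₂ → Matrix n n ℂ) :
    directSumA (ctrlA W₁) (ctrlA W₂) = ctrlA (Sum.elim W₁ W₂) := by
  ext ⟨i | i, j⟩ ⟨i' | i', j'⟩ <;> simp [directSumA, ctrlA_apply]

theorem directSumA_ctrlB [DecidableEq n] (V₁ : n → Matrix m₁ m₁ ℂ)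
    (V₂ : n → Matrix m₂ m₂ ℂ) :
    directSumA (ctrlB V₁) (ctrlB V₂) = ctrlB fun j => fromBlocks (V₁ j) 0 0 (V₂ j) := by
  ext ⟨i | i, j⟩ ⟨i' | i', j'⟩ <;> simp [directSumA, ctrlB_apply]

variable [Fintype m] [Fintype m₁] [Fintype m₂] [Fintype n]
  [DecidableEq m] [DecidableEq m₁] [DecidableEq m₂] [DecidableEq n]

/-- Alternating products of `2 ^ k` unitaries controlled by the first party and `2 ^ k - 1`
unitaries controlled by the second party. -/
def IsAlternatingProduct {m n : Type*} [Fintype m] [Fintype n] [DecidableEq m] [DecidableEq n] :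
    ℕ → Matrix (m × n) (m × n) ℂ → Prop
  | 0, U => ∃ W : m → Matrix n n ℂ, (∀ i, W i ∈ unitaryGroup n ℂ) ∧ U = ctrlA W
  | k + 1, U => ∃ U₁ V U₂, IsAlternatingProduct k U₁ ∧ (∀ j, V j ∈ unitaryGroup m ℂ) ∧
      IsAlternatingProduct k U₂ ∧ U = U₁ * ctrlB V * U₂

theorem submatrix_mem_unitaryGroup {l : Type*} [Fintype l] [DecidableEq l] (e : l ≃ m)
    {U : Matrix m m ℂ} (hU : U ∈ unitaryGroup m ℂ) : U.submatrix e e ∈ unitaryGroup l ℂ := by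
  rw [mem_unitaryGroup_iff, star_eq_conjTranspose] at *
  rw [conjTranspose_submatrix, submatrix_mul_equiv, hU, submatrix_one_equiv]

/-- The factors of the two summands are combined in parallel, one by one. The number of controlled
factors therefore does not add up over the two halves of a split. -/
theorem IsAlternatingProduct.directSumA {k : ℕ} {U₁ : Matrix (m₁ × n) (m₁ × n) ℂ}
    {U₂ : Matrix (m₂ × n) (m₂ × n) ℂ} (h₁ : IsAlternatingProduct k U₁)
    (h₂ : IsAlternatingProduct k U₂) : IsAlternatingProduct k (directSumA U₁ U₂) := by
  induction k generalizing U₁ U₂ with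
  | zero =>
    obtain ⟨W₁, hW₁, rfl⟩ := h₁
    obtain ⟨W₂, hW₂, rfl⟩ := h₂
    exact ⟨Sum.elim W₁ W₂, Sum.forall.2 ⟨hW₁, hW₂⟩, directSumA_ctrlA W₁ W₂⟩
  | succ k ih =>
    obtain ⟨U₁, V₁, U₁', hU₁, hV₁, hU₁', rfl⟩ := h₁
    obtain ⟨U₂, V₂, U₂', hU₂, hV₂, hU₂', rfl⟩ := h₂
    exact ⟨_, _, _, ih hU₁ hU₂, fun j => fromBlocks_diag_mem_unitaryGroup (hV₁ j) (hV₂ j),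
      ih hU₁' hU₂', by rw [directSumA_mul, directSumA_mul, directSumA_ctrlB]⟩

theorem IsAlternatingProduct.submatrix {k : ℕ} (e : m₁ ≃ m₂) {U : Matrix (m₂ × n) (m₂ × n) ℂ}
    (h : IsAlternatingProduct k U) :
    IsAlternatingProduct k (U.submatrix (e.prodCongr (Equiv.refl n))
      (e.prodCongr (Equiv.refl n))) := by
  induction k generalizing U with
  | zero =>
    obtain ⟨W, hW, rfl⟩ := h
    refine ⟨W ∘ e, fun i => hW _, ?_⟩
    ext ⟨i, j⟩ ⟨i', j'⟩
    simp [ctrlA_apply]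
  | succ k ih =>
    obtain ⟨U₁, V, U₂, hU₁, hV, hU₂, rfl⟩ := h
    refine ⟨_, fun j => (V j).submatrix e e, _, ih hU₁,
      fun j => submatrix_mem_unitaryGroup e (hV j), ih hU₂, ?_⟩
    rw [← submatrix_mul_equiv _ _ _ (e.prodCongr (Equiv.refl n)),
      ← submatrix_mul_equiv _ _ _ (e.prodCongr (Equiv.refl n))]
    rfl

theorem ctrlB_mem_unitaryGroup {V : n → Matrix m m ℂ} (hV : ∀ j, V j ∈ unitaryGroup m ℂ) :
    ctrlB V ∈ unitaryGroup (m × n) ℂ := by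
  rw [← swapParties_ctrlA]
  exact swapParties_mem_unitaryGroup (ctrlA_mem_unitaryGroup hV)

/-- If the first party splits into two parts, then a unitary is a product of two direct sums with
a unitary controlled by the second party in between. -/
theorem exists_eq_directSumA_mul_ctrlB_mul_directSumA (e : m₂ ↪ m₁)
    {U : Matrix ((m₁ ⊕ m₂) × n) ((m₁ ⊕ m₂) × n) ℂ}
    (hU : U ∈ unitaryGroup ((m₁ ⊕ m₂) × n) ℂ) :
    ∃ W ∈ unitaryGroup (m₁ × n) ℂ, ∃ Y ∈ unitaryGroup (m₂ × n) ℂ,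
      ∃ V : n → Matrix (m₁ ⊕ m₂) (m₁ ⊕ m₂) ℂ, (∀ j, V j ∈ unitaryGroup (m₁ ⊕ m₂) ℂ) ∧
      ∃ W' ∈ unitaryGroup (m₁ × n) ℂ, ∃ Y' ∈ unitaryGroup (m₂ × n) ℂ,
        U = directSumA W Y * ctrlB V * directSumA W' Y' := by
  let s := Equiv.sumProdDistrib m₁ m₂ n
  obtain ⟨W, hW, Y, hY, M, ⟨V, hV, rfl⟩, W', hW', Y', hY', h⟩ := exists_cosine_sine_decomposition
    (submatrix_mem_unitaryGroup s.symm hU) (P := fun M => ∃ V : n → Matrix (m₁ ⊕ m₂) (m₁ ⊕ m₂) ℂ,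
      (∀ j, V j ∈ unitaryGroup (m₁ ⊕ m₂) ℂ) ∧ M = (ctrlB V).submatrix s.symm s.symm)
    (fun c h0 h1 => by
      -- The corner has basis states `(i, j)`, and its rotations mix only first-party states while
      -- keeping `j`. So they assemble into one operator controlled by the second party.
      choose V hV hVc using fun j => exists_unitary_corner_eq_diagonal e
        (fun i => h0 (i, j)) (fun i => h1 (i, j))
      refine ⟨_, submatrix_mem_unitaryGroup s.symm (ctrlB_mem_unitaryGroup hV), ?_, V, hV, rfl⟩
      ext ⟨i, j⟩ ⟨i', j'⟩
      by_cases hj : j = j'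
      · subst hj
        have := congrFun (congrFun (hVc j) i) i'
        rw [toBlocks₂₂, of_apply, diagonal_apply] at this
        simp [toBlocks₂₂, ctrlB_apply, s, this, diagonal_apply]
      · simp [toBlocks₂₂, ctrlB_apply, s, hj])
  refine ⟨W, hW, Y, hY, V, hV, W', hW', Y', hY', ?_⟩
  have := congrArg (fun X => X.submatrix s s) h
  simp only [submatrix_submatrix, Equiv.symm_comp_self, submatrix_id_id] at this
  rw [this, ← submatrix_mul_equiv _ _ _ s, ← submatrix_mul_equiv _ _ _ s, submatrix_submatrix,
    Equiv.symm_comp_self, submatrix_id_id]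
  rfl

theorem isAlternatingProduct_of_mem_unitaryGroup {d k : ℕ} (hd : d ≤ 2 ^ k)
    {U : Matrix (Fin d × n) (Fin d × n) ℂ} (hU : U ∈ unitaryGroup (Fin d × n) ℂ) :
    IsAlternatingProduct k U := by
  induction k generalizing d with
  | zero =>
    have : Subsingleton (Fin d) := Fin.subsingleton_iff_le_one.2 (by simpa using hd)
    have hUW : U = ctrlA fun i => U.submatrix (fun j => (i, j)) fun j => (i, j) := by
      ext ⟨i, j⟩ ⟨i', j'⟩
      obtain rfl : i = i' := Subsingleton.elim _ _
      simp [ctrlA_apply]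
    refine ⟨_, fun i => ?_, hUW⟩
    have : Unique (Fin d) := uniqueOfSubsingleton i
    have he : (fun j : n => (i, j)) = (Equiv.uniqueProd n (Fin d)).symm := by
      ext1 j
      exact Prod.ext (Subsingleton.elim _ _) rfl
    rw [he]
    exact submatrix_mem_unitaryGroup _ hU
  | succ k ih =>
    obtain ⟨a, b, hba, rfl, ha, hb⟩ : ∃ a b, b ≤ a ∧ a + b = d ∧ a ≤ 2 ^ k ∧ b ≤ 2 ^ k := by
      rw [pow_succ] at hd
      -- The larger half comes first because the smaller one must embed into it for the rotation
      -- planes.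
      exact ⟨d - d / 2, d / 2, by omega, by omega, by omega, by omega⟩
    let f : Fin a ⊕ Fin b ≃ Fin (a + b) := finSumFinEquiv
    obtain ⟨W, hW, Y, hY, V, hV, W', hW', Y', hY', h⟩ :=
      exists_eq_directSumA_mul_ctrlB_mul_directSumA (Fin.castLEEmb hba)
        (submatrix_mem_unitaryGroup (f.prodCongr (Equiv.refl n)) hU)
    have key : IsAlternatingProduct (k + 1) (U.submatrix (f.prodCongr (Equiv.refl n))
        (f.prodCongr (Equiv.refl n))) :=
      ⟨_, V, _, (ih ha hW).directSumA (ih hb hY), hV, (ih ha hW').directSumA (ih hb hY'), h⟩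
    have hback := key.submatrix f.symm
    rw [submatrix_submatrix] at hback
    convert hback using 1
    ext ⟨i, j⟩ ⟨i', j'⟩
    simp

end Alternating

/-! ### Gate count for arbitrary unitaries. -/

section UnitaryCount

variable {dA dB : ℕ}

theorem IsAlternatingProduct.isProductOfAtMost (hA : 1 ≤ dA) (hB : 1 ≤ dB) {k : ℕ}
    {U : BipartiteMatrix dA dB} (hU : IsAlternatingProduct k U) :
    IsProductOfAtMost IsStandardGate IsLocalUnitary
      (2 ^ k * ((dA - 1) * (dB / 2)) + (2 ^ k - 1) * ((dB - 1) * (dA / 2))) U := by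
  induction k generalizing U with
  | zero =>
    obtain ⟨W, hW, rfl⟩ := hU
    simpa using isProductOfAtMost_ctrlA hA hW
  | succ k ih =>
    obtain ⟨U₁, V, U₂, hU₁, hV, hU₂, rfl⟩ := hU
    refine (((ih hU₁).mul IsLocalUnitary.mul (isProductOfAtMost_ctrlB hB hV)).mul
      IsLocalUnitary.mul (ih hU₂)).mono (le_of_eq ?_)
    obtain ⟨t, ht⟩ : ∃ t, 2 ^ k = t + 1 := ⟨2 ^ k - 1, (Nat.sub_add_cancel Nat.one_le_two_pow).symm⟩
    have h1 : 2 ^ k - 1 = t := by omega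
    have h2 : 2 ^ (k + 1) - 1 = 2 * t + 1 := by rw [pow_succ]; omega
    rw [h1, h2, pow_succ, ht]
    ring

theorem isProductOfAtMost_of_mem_unitaryGroup (hA : 1 ≤ dA) (hB : 1 ≤ dB)
    {U : BipartiteMatrix dA dB} (hU : U ∈ unitaryGroup (Fin dA × Fin dB) ℂ) :
    IsProductOfAtMost IsStandardGate IsLocalUnitary
      (2 * (dA - 1) ^ 2 * (dB / 2) + (2 * dA - 3) * (dB - 1) * (dA / 2)) U := by
  refine ((isAlternatingProduct_of_mem_unitaryGroup (Nat.le_pow_clog one_lt_two dA)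
    hU).isProductOfAtMost hA hB).mono ?_
  obtain rfl | hA : dA = 1 ∨ 2 ≤ dA := by omega
  · simp
  -- By minimality of the exponent, `2 ^ (clog - 1) < dA`.
  have h1 : 2 ^ Nat.clog 2 dA ≤ 2 * (dA - 1) := by
    have h2 := Nat.pow_pred_clog_lt_self one_lt_two hA
    have h3 : 0 < Nat.clog 2 dA := Nat.clog_pos one_lt_two hA
    rw [← Nat.succ_pred_eq_of_pos h3, pow_succ]
    omega
  refine add_le_add ?_ ?_
  · calc _ ≤ 2 * (dA - 1) * ((dA - 1) * (dB / 2)) := Nat.mul_le_mul_right _ h1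
      _ = _ := by ring
  · rw [mul_assoc]
    exact Nat.mul_le_mul_right _ (by omega)

end UnitaryCount

/-- For `dA = 1` the truncated factor `2 * dA - 3` is multiplied by `dA / 2 = 0`, so that the
natural-number counts agree with the integer ones for all `dA, dB ≥ 1`. -/
theorem proposition4 (dA dB : ℕ) (hA : 1 ≤ dA) (hB : 1 ≤ dB) :
    -- arbitrary bipartite unitaries
    (∀ U : BipartiteMatrix dA dB, U ∈ Matrix.unitaryGroup (Fin dA × Fin dB) ℂ →
      ∃ n : ℕ, n ≤ 2 * (dA - 1) ^ 2 * (dB / 2) + (2 * dA - 3) * (dB - 1) * (dA / 2) ∧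
        IsProductOfGates IsStandardGate IsLocalUnitary n U) ∧
    -- controlled unitaries controlled from the A side
    (∀ U : BipartiteMatrix dA dB, IsControlledFromA U →
      ∃ n : ℕ, n ≤ (dA - 1) * (dB / 2) ∧
        IsProductOfGates IsStandardGate IsLocalUnitary n U) ∧
    -- complex permutation unitaries
    (∀ U : BipartiteMatrix dA dB, IsComplexPermutation U →
      ∃ n : ℕ, n ≤ 2 * (dA - 1) * (dB / 2) + (dB - 1) * (dA / 2) ∧
        IsProductOfGates IsStandardGate IsLocalUnitary n U) ∧
    -- permutation unitaries, with CNOT-type standard gates and local permutation gates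
    (∀ σ : Equiv.Perm (Fin dA × Fin dB),
      ∃ n : ℕ, n ≤ 3 * (dA - 1) * (dB - 1) ∧
        IsProductOfGates IsCNOTGate IsLocalPermutation n (σ.permMatrix ℂ)) := by
  refine ⟨fun U hU => isProductOfAtMost_of_mem_unitaryGroup hA hB hU, ?_,
    fun U hU => hU.isProductOfAtMost hA hB, fun σ => isProductOfAtMost_permMatrix hA hB σ⟩
  rintro _ ⟨K, L, W, hK, hL, hW, rfl⟩
  rw [← ctrlA_eq_sum]
  exact ((isProductOfAtMost_ctrlA hA hW).loc_mul IsLocalUnitary.mul hK).mul_loc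
    IsLocalUnitary.mul hL
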